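/- **Theorem 2 (Consistency of LBI).** *Setting.* Let $V$ be a set of $n$ items and $E$ a set of $m$ paired comparisons, each comparing two distinct items, whose comparison graph $G=(V,E)$ is connected (repeated comparisons of a pair are allowed). Let $X:\mathbb R^V\to\mathbb R^E$, $(X\theta)_e=\theta_i-\theta_j$ for $e=(i,j)$. The data are $Y=X\theta^\ast+\gamma+\varepsilon$ with $\theta^\ast\in\mathbb R^V$ and $\gamma\in\mathbb R^E$ (the outliers) fixed, and $\varepsilon$ having independent $N(0,\sigma^2)$ entries, $\sigma>0$. Let $l=m-n+1$ and let $\Psi\in\mathbb R^{l\times m}$ have rows forming an orthonormal basis of $\ker X^T$. Put $S={\rm supp}(\gamma)$, $s=|S|$, $\gamma_{\max}=\max_{i\in S}|\gamma_i|$, $\gamma_{\min}=\min_{i\in S}|\gamma_i|$, let $\Psi_S$, $\Psi_{S^c}$ be the submatrices of columns of $\Psi$ with index in $S$, $S^c$, and put $\mu_\Psi=\max_{j\in S^c}\frac1l\|\Psi_j\|_2^2$, $\Psi_j$ being the $j$-th column. Assume * (C1) $C_{\min}:=\Lambda_{\min}\big(\frac1l\Psi_S^T\Psi_S\big)>0$,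 where $\Lambda_{\min}$ is the smallest eigenvalue (in particular $S\neq\emptyset$); * (C2) for some $\eta\in(0,1]$, $\|\Psi_{S^c}^T\Psi_S(\Psi_S^T\Psi_S)^{-1}\|_\infty\le 1-\eta$, where $\|\cdot\|_\infty$ is the maximal absolute row sum. For $\kappa>0$ and $\triangle t>0$ the Linearized Bregman Iteration is $z^0=\gamma^0=0$, $$z^{k+1}=z^k+\big(I-X(X^TX)^\dagger X^T\big)(Y-\gamma^k)\,\triangle t,\qquad \gamma^{k+1}=\kappa\,\mathrm{shrink}(z^{k+1}),$$ where $\dagger$ denotes the Moore-Penrose inverse and $\mathrm{shrink}(x)={\rm sign}(x)\max(|x|-1,0)$ acts entrywise. Let $h=\kappa\triangle t$, $t^k=k\triangle t$, $$B=\gamma_{\max}+2\sigma\sqrt{\frac{\log m}{C_{\min}l}}+\frac{\|\Psi\gamma\|_2+2\sigma s\sqrt{\log l}}{\sqrt{l\,C_{\min}}},\qquad \bar\tau=\frac{(1-B/(\kappa\eta))\,\eta}{2\sigma\sqrt{\mu_\Psi}}\sqrt{\frac1{l\log m}},$$ and $\tilde C_{\min}=C_{\min}l\,(1-h\|\Psi_S\Psi_S^T\|/2)$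 with the spectral norm. *Statement.* Assume $B\le\kappa\eta$ and $h\|\Psi_S\Psi_S^T\|<2$. Then there is an event of probability at least $1-\frac1{m\sqrt{\log m}}-\frac2{n\sqrt{\log n}}$ on which all of the following hold. * (No false positive) ${\rm supp}(\gamma^k)\subseteq S$ for all $k$ with $t^k\le\bar\tau$. * (Sign consistency) If $\gamma_{\min}\ge\frac{4\sigma}{C_{\min}^{1/2}}\sqrt{\frac{\log m}{l}}$ and $$\bar\tau\ge\frac{8+4\log s}{\tilde C_{\min}\gamma_{\min}}+\frac1{\kappa\tilde C_{\min}}\log\Big(\frac{3\|\gamma\|_2}{\gamma_{\min}}\Big)+3\triangle t,$$ then ${\rm sign}(\gamma^{k^\ast})={\rm sign}(\gamma)$ for $k^\ast=\lfloor\bar\tau/\triangle t\rfloor$. * ($\ell_2$ bound) For every $C>0$ with $$\bar\tau\ge\frac1{2\kappa\tilde C_{\min}}\Big(1+\log\frac{l\|\gamma\|_2^2+4\sigma^2s\log m/C_{\min}}{C^2s\log m}\Big)+\frac4{C\tilde C_{\min}}\sqrt{\frac l{\log m}}+2\triangle t$$ there is a $k^\ast$ with $t^{k^\ast}\le\bar\tau$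 and $$\|\gamma^{k^\ast}-\gamma\|_2\le\Big(C+\frac{2\sigma}{C_{\min}^{1/2}}\Big)\sqrt{\frac{s\log m}{l}}.$$ -/

import Mathlib

open MeasureTheory ProbabilityTheory
open scoped Matrix

/-- Paired comparison data on a set of items `V`: each comparison `e : E` compares the item
`src e` with a different item `tgt e`. A pair of items may be compared several times
(for instance by several raters). -/
structure ComparisonGraph (V E : Type*) where
  src : E → V
  tgt : E → V
  src_ne_tgt : ∀ e, src e ≠ tgt e

namespace ComparisonGraph

variable {V E : Type*}

/-- The graph on the items in which two items are adjacent when they have been compared. -/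
def simpleGraph (G : ComparisonGraph V E) : SimpleGraph V :=
  SimpleGraph.fromRel (fun i j => ∃ e, G.src e = i ∧ G.tgt e = j)

/-- The design matrix `X = δ₀` (graph gradient), `(X θ) e = θ (src e) - θ (tgt e)`. -/
def gradient [DecidableEq V] (G : ComparisonGraph V E) : Matrix E V ℝ :=
  Matrix.of fun e i => (if G.src e = i then 1 else 0) - (if G.tgt e = i then 1 else 0)

/-- Sanity check for the gradient. -/
theorem gradient_mulVec [Fintype V] [DecidableEq V] (G : ComparisonGraph V E) (θ : V → ℝ)
    (e : E) : (G.gradient *ᵥ θ) e = θ (G.src e) - θ (G.tgt e) := by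
  simp [gradient, Matrix.mulVec, dotProduct, sub_mul, Finset.sum_sub_distrib]

end ComparisonGraph

namespace LBI

/-! ### Moore-Penrose inverse -/

/-- The four Penrose equations for real matrices. -/
structure IsMoorePenrose {ι κ : Type*} [Fintype ι] [Fintype κ]
    (A : Matrix ι κ ℝ) (B : Matrix κ ι ℝ) : Prop where
  mul_mul_left : A * B * A = A
  mul_mul_right : B * A * B = B
  symm_left : (A * B)ᵀ = A * B
  symm_right : (B * A)ᵀ = B * A

open Classical in
/-- The Moore-Penrose inverse: the solution of the Penrose equations. -/
noncomputable def pinv {ι κ : Type*} [Fintype ι] [Fintype κ] (A : Matrix ι κ ℝ) :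
    Matrix κ ι ℝ :=
  if h : ∃ B, IsMoorePenrose A B then h.choose else 0

/-- A real symmetric matrix has a Moore-Penrose inverse, so that `pinv` is not the default
value on Gram matrices. -/
theorem exists_isMoorePenrose {ι : Type*} [Fintype ι] [DecidableEq ι] {A : Matrix ι ι ℝ}
    (hA : A.IsHermitian) : ∃ B, IsMoorePenrose A B := by
  set U : Matrix ι ι ℝ := (hA.eigenvectorUnitary : Matrix ι ι ℝ) with hU
  set d : ι → ℝ := hA.eigenvalues with hd
  have hUU : Uᵀ * U = 1 := by
    have h := Unitary.coe_star_mul_self hA.eigenvectorUnitary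
    rwa [Matrix.star_eq_conjTranspose, Matrix.conjTranspose_eq_transpose_of_trivial] at h
  have hs : A = U * Matrix.diagonal d * Uᵀ := by
    have h := hA.spectral_theorem
    rwa [Unitary.conjStarAlgAut_apply, Matrix.star_eq_conjTranspose,
      Matrix.conjTranspose_eq_transpose_of_trivial] at h
  have key : ∀ a b : ι → ℝ, (U * Matrix.diagonal a * Uᵀ) * (U * Matrix.diagonal b * Uᵀ)
      = U * Matrix.diagonal (fun i => a i * b i) * Uᵀ := by
    intro a b
    calc (U * Matrix.diagonal a * Uᵀ) * (U * Matrix.diagonal b * Uᵀ)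
        = U * Matrix.diagonal a * (Uᵀ * U) * Matrix.diagonal b * Uᵀ := by
          simp only [Matrix.mul_assoc]
      _ = _ := by
          rw [hUU, Matrix.mul_one, Matrix.mul_assoc U, Matrix.diagonal_mul_diagonal]
  have tr : ∀ a : ι → ℝ, (U * Matrix.diagonal a * Uᵀ)ᵀ = U * Matrix.diagonal a * Uᵀ := by
    intro a
    simp [Matrix.transpose_mul, Matrix.mul_assoc]
  refine ⟨U * Matrix.diagonal (fun i => (d i)⁻¹) * Uᵀ, ?_, ?_, ?_, ?_⟩
  · rw [hs, key, key]
    congr 3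
    funext i
    exact mul_inv_mul_cancel (d i)
  · rw [hs, key, key]
    congr 3
    funext i
    simpa using mul_inv_mul_cancel (d i)⁻¹
  · rw [hs, key, tr]
  · rw [hs, key, tr]

theorem isMoorePenrose_pinv_gram {ι κ : Type*} [Fintype ι] [Fintype κ] (X : Matrix ι κ ℝ) :
    IsMoorePenrose (Xᵀ * X) (pinv (Xᵀ * X)) := by
  classical
  have h : ∃ B, IsMoorePenrose (Xᵀ * X) B :=
    exists_isMoorePenrose (by
      rw [Matrix.IsHermitian, Matrix.conjTranspose_eq_transpose_of_trivial,
        Matrix.transpose_mul, Matrix.transpose_transpose])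
  rw [pinv, dif_pos h]
  exact h.choose_spec

/-! ### The algorithm -/

/-- Soft thresholding with threshold one. -/
noncomputable def shrink (x : ℝ) : ℝ := Real.sign x * max (|x| - 1) 0

/-- The pairs `(z^k, γ^k)` of the Linearized Bregman Iteration with design matrix `X`, data `Y`,
damping factor `κ` and step size `Δt`: `z^0 = γ^0 = 0`,
`z^{k+1} = z^k + (I - X (XᵀX)† Xᵀ) (Y - γ^k) Δt`, `γ^{k+1} = κ shrink (z^{k+1})`. -/
noncomputable def lbi {V E : Type*} [Fintype V] [Fintype E] [DecidableEq E]
    (X : Matrix E V ℝ) (κ Δt : ℝ) (Y : E → ℝ) : ℕ → (E → ℝ) × (E → ℝ)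
  | 0 => (0, 0)
  | k + 1 =>
    let z : E → ℝ := (lbi X κ Δt Y k).1 +
      Δt • ((1 - X * pinv (Xᵀ * X) * Xᵀ) *ᵥ (Y - (lbi X κ Δt Y k).2))
    (z, fun e => κ * shrink (z e))

/-- The iterate `γ^k` of the Linearized Bregman Iteration. -/
noncomputable def lbiPath {V E : Type*} [Fintype V] [Fintype E] [DecidableEq E]
    (X : Matrix E V ℝ) (κ Δt : ℝ) (Y : E → ℝ) (k : ℕ) : E → ℝ :=
  (lbi X κ Δt Y k).2

/-! ### The quantities attached to `Ψ = U₂ᵀ` and to the outlier vector -/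

/-- The number `l = m - n + 1` of rows of `Ψ` (for a connected graph `n ≤ m + 1`). -/
abbrev numRows (V E : Type*) [Fintype V] [Fintype E] : ℕ :=
  Fintype.card E + 1 - Fintype.card V

/-- The rows of `Ψ` form an orthonormal basis of `ker Xᵀ`. -/
def IsKerBasis {V E : Type*} [Fintype E] {l : ℕ} (X : Matrix E V ℝ)
    (Ψ : Matrix (Fin l) E ℝ) : Prop :=
  Ψ * Ψᵀ = 1 ∧ Submodule.span ℝ (Set.range fun r => Ψ r) = LinearMap.ker (Xᵀ.mulVecLin)

/-- The support `{e | γ e ≠ 0}`. -/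
noncomputable def supp {E : Type*} [Fintype E] (γ : E → ℝ) : Finset E :=
  Finset.univ.filter fun e => γ e ≠ 0

/-- The submatrix of the columns of `Ψ` with index in `S`. -/
def cols {E : Type*} {l : ℕ} (Ψ : Matrix (Fin l) E ℝ) (S : Finset E) : Matrix (Fin l) S ℝ :=
  Ψ.submatrix id Subtype.val

/-- The Euclidean norm of a finite real vector. -/
noncomputable def norm2 {ι : Type*} [Fintype ι] (v : ι → ℝ) : ℝ := Real.sqrt (∑ i, v i ^ 2)

/-- The smallest eigenvalue of a real symmetric matrix. -/
noncomputable def lamMin {ι : Type*} [Fintype ι] [DecidableEq ι] (A : Matrix ι ι ℝ) : ℝ :=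
  sInf (spectrum ℝ A)

/-- The spectral norm. -/
noncomputable def specNorm {ι : Type*} [Fintype ι] [DecidableEq ι] (A : Matrix ι ι ℝ) : ℝ :=
  ‖Matrix.toEuclideanCLM (n := ι) (𝕜 := ℝ) A‖

/-- The matrix norm `‖·‖_∞`: the largest absolute row sum. -/
noncomputable def rowSumNorm {ι κ : Type*} [Fintype κ] (A : Matrix ι κ ℝ) : ℝ :=
  ⨆ i, ∑ j, |A i j|

section

variable {E : Type*} [Fintype E] [DecidableEq E] {l : ℕ}

/-- `C_min = Λ_min ((1/l) Ψ_Sᵀ Ψ_S)` (it is `0` if `S` is empty). -/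
noncomputable def cMin (Ψ : Matrix (Fin l) E ℝ) (S : Finset E) : ℝ :=
  lamMin ((1 / (l : ℝ)) • ((cols Ψ S)ᵀ * cols Ψ S))

/-- `‖Ψ_{Sᶜ}ᵀ Ψ_S (Ψ_Sᵀ Ψ_S)⁻¹‖_∞`. -/
noncomputable def irrep (Ψ : Matrix (Fin l) E ℝ) (S : Finset E) : ℝ :=
  rowSumNorm ((cols Ψ Sᶜ)ᵀ * cols Ψ S * ((cols Ψ S)ᵀ * cols Ψ S)⁻¹)

/-- `μ_Ψ = max_{j ∈ Sᶜ} ‖Ψ_j‖₂² / l`. -/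
noncomputable def muPsi (Ψ : Matrix (Fin l) E ℝ) (S : Finset E) : ℝ :=
  ⨆ j : ↥Sᶜ, 1 / (l : ℝ) * ∑ r, Ψ r j ^ 2

/-- `γ_max`, the largest magnitude of an outlier. -/
noncomputable def gammaMax (γ : E → ℝ) : ℝ := ⨆ i : supp γ, |γ i|

/-- `γ_min`, the smallest magnitude of an outlier. -/
noncomputable def gammaMin (γ : E → ℝ) : ℝ := ⨅ i : supp γ, |γ i|

/-- `B = γ_max + 2σ √(log m / (C_min l)) + (‖Ψγ‖₂ + 2 σ s √(log l)) / √(l C_min)`. -/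
noncomputable def boundB (Ψ : Matrix (Fin l) E ℝ) (γ : E → ℝ) (σ : ℝ) : ℝ :=
  gammaMax γ
    + 2 * σ * Real.sqrt (Real.log (Fintype.card E) / (cMin Ψ (supp γ) * l))
    + (norm2 (Ψ *ᵥ γ) + 2 * σ * (supp γ).card * Real.sqrt (Real.log l))
        / Real.sqrt (l * cMin Ψ (supp γ))

/-- `τ̄ = (1 - B / (κ η)) η / (2 σ √μ_Ψ) · √(1 / (l log m))`. -/
noncomputable def tauBar (Ψ : Matrix (Fin l) E ℝ) (γ : E → ℝ) (σ η κ : ℝ) : ℝ :=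
  (1 - boundB Ψ γ σ / (κ * η)) * η / (2 * σ * Real.sqrt (muPsi Ψ (supp γ)))
    * Real.sqrt (1 / (l * Real.log (Fintype.card E)))

/-- `C̃_min = C_min l (1 - h ‖Ψ_S Ψ_Sᵀ‖ / 2)`. -/
noncomputable def cTilde (Ψ : Matrix (Fin l) E ℝ) (S : Finset E) (h : ℝ) : ℝ :=
  cMin Ψ S * l * (1 - h * specNorm (cols Ψ S * (cols Ψ S)ᵀ) / 2)

end

end LBI

namespace LBI

/-! ### Soft thresholding -/

/-! Since `1 - X (XᵀX)† Xᵀ = Ψᵀ Ψ` and `Ψ X = 0`, the iteration sees the data only through `Ψ γ +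
w`, where `w = Ψ ε`. Write `A` for the columns of `Ψ` on the support `S` and split `w = A ν + p`,
with `ν` the least squares solution and `Aᵀ p = 0`. While the iterates vanish off `S`, they follow
on `S` the Bregman iteration with noiseless data `A g₀`, `g₀ = γ_S + ν`. The dual variable at an
index `j` off `S` is then `q_j ⬝ z_S + t (Ψ_j ⬝ p)`, where `q_j` is the least squares solution for
`Ψ_j` (`full_path_eq`). It remains to keep these numbers in `[-1, 1]` and to study the restricted
iteration.

The first task is `abs_off_support_le`. One bound on `q_j ⬝ z_S` grows linearly in time, because the
residual never increases (`residual_le`); another combines `‖q_j‖₁ ≤ 1 - η` with `|z| ≤ 1 + |g| /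
κ`. Noise enters both `A g₀` and the coordinates of `g₀`, while `boundB` pays for `2σ√(log m)` once;
a case distinction on the size of the residual closes this gap.

For the second task, the Bregman distance plus `‖g - g₀‖² / (2κ)` drops at each step by a multiple
of `‖g - g₀‖²` (`potential_succ_le`). It is also bounded by a function `F` of `‖g - g₀‖²`, because
the Bregman term of a coordinate vanishes as soon as the iterate is closer to `g₀ i` than zero is.
`discrete_bihari` turns these two facts into a time bound: `dist_lt_min` yields the signs,
`exists_dist_le` the error bound.

Probability enters only through one linear form of the noise per comparison, controlled by a union
bound, and the norm of the projection of `w` on the range of `A`, controlled by a Chernoff bound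
(`exists_noise_event`). -/

theorem shrink_eq (x : ℝ) :
    shrink x = if 1 < x then x - 1 else if x < -1 then x + 1 else 0 := by
  unfold shrink
  split_ifs with h1 h2
  · rw [Real.sign_of_pos (by linarith), abs_of_pos (by linarith), max_eq_left (by linarith)]
    ring
  · rw [Real.sign_of_neg (by linarith), abs_of_neg (by linarith), max_eq_left (by linarith)]
    ring
  · rw [max_eq_right, mul_zero]
    have := abs_le.2 ⟨not_lt.1 h2, not_lt.1 h1⟩
    linarith

theorem shrink_eq_zero {x : ℝ} (hx : |x| ≤ 1) : shrink x = 0 := by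
  have := abs_le.1 hx
  rw [shrink_eq, if_neg (by linarith), if_neg (by linarith)]

theorem abs_sub_shrink_le (x : ℝ) : |x - shrink x| ≤ 1 := by
  rw [shrink_eq]
  split_ifs <;> rw [abs_le] <;> constructor <;> linarith

theorem shrink_mul_sub_shrink (x : ℝ) : shrink x * (x - shrink x) = |shrink x| := by
  rw [shrink_eq]
  split_ifs with h1 h2
  · rw [abs_of_pos (by linarith)]; ring
  · rw [abs_of_neg (by linarith)]; ring
  · simp

theorem sq_shrink_sub_le (x y : ℝ) :
    (shrink y - shrink x) ^ 2 ≤ (y - x) * (shrink y - shrink x) := by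
  rw [shrink_eq, shrink_eq]
  split_ifs <;> nlinarith

/-- Split `y - x` into the increments of `shrink` and of the clipped part `x - shrink x`. After
expanding the square, what is left to be nonnegative is half the squared clipped increment plus
`shrink y` times that increment, and the latter is monotonicity of the subgradient of `|·|`. -/
theorem shrink_potential_le (x y : ℝ) :
    (shrink y - shrink x) ^ 2 / 2 + ((x - shrink x) - (y - shrink y)) * shrink x
      ≤ (y - x) ^ 2 / 2 := by
  have h1 : 0 ≤ shrink y * ((y - shrink y) - (x - shrink x)) := by
    have h2 := shrink_mul_sub_shrink y
    have h3 : shrink y * (x - shrink x) ≤ |shrink y| := by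
      refine (le_abs_self _).trans ?_
      rw [abs_mul]
      exact mul_le_of_le_one_right (abs_nonneg _) (abs_sub_shrink_le x)
    nlinarith
  nlinarith [sq_nonneg ((y - shrink y) - (x - shrink x))]

/-! ### The iteration restricted to a set of coordinates -/

variable {ρ ι : Type*} [Fintype ρ] [Fintype ι]

/-- The Linearized Bregman Iteration for the noiseless data `A g₀`. -/
structure IsBregmanPath (A : Matrix ρ ι ℝ) (g₀ : ι → ℝ) (κ Δt : ℝ) (z g : ℕ → ι → ℝ) :
    Prop where
  z_zero : z 0 = 0
  z_succ : ∀ k, z (k + 1) = z k + Δt • (Aᵀ *ᵥ (A *ᵥ (g₀ - g k)))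
  g_eq : ∀ k i, g k i = κ * shrink (z k i)

theorem dotProduct_self_nonneg' (v : ι → ℝ) : 0 ≤ v ⬝ᵥ v :=
  Finset.sum_nonneg fun i _ => mul_self_nonneg (v i)

theorem dotProduct_sq_le (u v : ι → ℝ) : (u ⬝ᵥ v) ^ 2 ≤ (u ⬝ᵥ u) * (v ⬝ᵥ v) := by
  have h := Finset.sum_mul_sq_le_sq_mul_sq Finset.univ u v
  simpa only [dotProduct, ← sq] using h

theorem transpose_mulVec_dotProduct (A : Matrix ρ ι ℝ) (u : ρ → ℝ) (v : ι → ℝ) :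
    (Aᵀ *ᵥ u) ⬝ᵥ v = u ⬝ᵥ (A *ᵥ v) := by
  rw [Matrix.mulVec_transpose, Matrix.dotProduct_mulVec]

/-- A matrix and its transpose have the same operator norm: Cauchy-Schwarz applied to `‖A v‖² = Aᵀ
(A v) ⬝ v`, then division by `‖A v‖²`. -/
theorem mulVec_dotProduct_self_le {A : Matrix ρ ι ℝ} {r : ℝ} (hr0 : 0 ≤ r)
    (hr : ∀ u, (Aᵀ *ᵥ u) ⬝ᵥ (Aᵀ *ᵥ u) ≤ r * (u ⬝ᵥ u)) (v : ι → ℝ) :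
    (A *ᵥ v) ⬝ᵥ (A *ᵥ v) ≤ r * (v ⬝ᵥ v) := by
  set a := A *ᵥ v with ha
  have h1 : a ⬝ᵥ a = (Aᵀ *ᵥ a) ⬝ᵥ v := by rw [transpose_mulVec_dotProduct]
  have h2 := dotProduct_sq_le (Aᵀ *ᵥ a) v
  rw [← h1] at h2
  have h3 := hr a
  have h4 := dotProduct_self_nonneg' a
  have h5 := dotProduct_self_nonneg' v
  rcases h4.eq_or_lt with h | h
  · rw [← h]
    positivity
  · have h6 : (a ⬝ᵥ a) * (a ⬝ᵥ a) ≤ (r * (v ⬝ᵥ v)) * (a ⬝ᵥ a) := by nlinarith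
    exact le_of_mul_le_mul_right h6 h

namespace IsBregmanPath

variable {A : Matrix ρ ι ℝ} {g₀ : ι → ℝ} {κ Δt r : ℝ} {z g : ℕ → ι → ℝ}

theorem g_zero (hp : IsBregmanPath A g₀ κ Δt z g) : g 0 = 0 := by
  ext i
  rw [hp.g_eq, hp.z_zero, shrink_eq_zero (by simp)]
  simp

theorem transpose_mulVec_residual (hp : IsBregmanPath A g₀ κ Δt z g) (k : ℕ) :
    Δt • (Aᵀ *ᵥ (A *ᵥ (g k - g₀))) = -(z (k + 1) - z k) := by
  rw [hp.z_succ, add_sub_cancel_left, ← neg_sub g₀, Matrix.mulVec_neg, Matrix.mulVec_neg, smul_neg]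

/-- Firm nonexpansiveness of `shrink` makes the cross term at most `-‖v‖² / (κ Δt)` for the
increment `v`; twice this outweighs `‖A v‖² ≤ r ‖v‖²` under the step size condition. -/
theorem residual_succ_le (hp : IsBregmanPath A g₀ κ Δt z g) (hκ : 0 < κ) (hΔt : 0 < Δt)
    (hr0 : 0 ≤ r) (hr : ∀ u, (Aᵀ *ᵥ u) ⬝ᵥ (Aᵀ *ᵥ u) ≤ r * (u ⬝ᵥ u))
    (hstep : κ * Δt * r ≤ 2) (k : ℕ) :
    (A *ᵥ (g (k + 1) - g₀)) ⬝ᵥ (A *ᵥ (g (k + 1) - g₀))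
      ≤ (A *ᵥ (g k - g₀)) ⬝ᵥ (A *ᵥ (g k - g₀)) := by
  set a := A *ᵥ (g k - g₀) with ha
  set v := g (k + 1) - g k with hv
  have h1 : A *ᵥ (g (k + 1) - g₀) = a + A *ᵥ v := by
    rw [ha, hv, ← Matrix.mulVec_add]
    congr 1
    abel
  have h2 := mulVec_dotProduct_self_le hr0 hr v
  have h3 : Δt * (a ⬝ᵥ (A *ᵥ v)) = -((z (k + 1) - z k) ⬝ᵥ v) := by
    rw [← transpose_mulVec_dotProduct, ← smul_eq_mul, ← smul_dotProduct, ha,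
      hp.transpose_mulVec_residual, neg_dotProduct]
  have h4 : v ⬝ᵥ v ≤ κ * ((z (k + 1) - z k) ⬝ᵥ v) := by
    simp only [dotProduct, Finset.mul_sum]
    refine Finset.sum_le_sum fun i _ => ?_
    simp only [hv, Pi.sub_apply, hp.g_eq]
    have := sq_shrink_sub_le (z k i) (z (k + 1) i)
    nlinarith [mul_le_mul_of_nonneg_left this (sq_nonneg κ)]
  have h5 := dotProduct_self_nonneg' v
  rw [h1, add_dotProduct, dotProduct_add, dotProduct_add, dotProduct_comm (A *ᵥ v) a]
  have h6 : κ * Δt * ((A *ᵥ v) ⬝ᵥ (A *ᵥ v)) ≤ 2 * (v ⬝ᵥ v) := by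
    calc κ * Δt * ((A *ᵥ v) ⬝ᵥ (A *ᵥ v)) ≤ κ * Δt * (r * (v ⬝ᵥ v)) := by gcongr
      _ = κ * Δt * r * (v ⬝ᵥ v) := by ring
      _ ≤ 2 * (v ⬝ᵥ v) := by gcongr
  have h7 : κ * Δt * (2 * (a ⬝ᵥ (A *ᵥ v)) + (A *ᵥ v) ⬝ᵥ (A *ᵥ v)) ≤ 0 := by
    have : κ * Δt * (a ⬝ᵥ (A *ᵥ v)) = κ * -((z (k + 1) - z k) ⬝ᵥ v) := by rw [← h3]; ring
    nlinarith
  have h8 : 2 * (a ⬝ᵥ (A *ᵥ v)) + (A *ᵥ v) ⬝ᵥ (A *ᵥ v) ≤ 0 :=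
    nonpos_of_mul_nonpos_right h7 (by positivity)
  linarith

theorem residual_le (hp : IsBregmanPath A g₀ κ Δt z g) (hκ : 0 < κ) (hΔt : 0 < Δt)
    (hr0 : 0 ≤ r) (hr : ∀ u, (Aᵀ *ᵥ u) ⬝ᵥ (Aᵀ *ᵥ u) ≤ r * (u ⬝ᵥ u))
    (hstep : κ * Δt * r ≤ 2) (k : ℕ) :
    (A *ᵥ (g k - g₀)) ⬝ᵥ (A *ᵥ (g k - g₀)) ≤ (A *ᵥ g₀) ⬝ᵥ (A *ᵥ g₀) := by
  induction k with
  | zero => rw [hp.g_zero, zero_sub, Matrix.mulVec_neg, neg_dotProduct_neg]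
  | succ k ih => exact (hp.residual_succ_le hκ hΔt hr0 hr hstep k).trans ih

end IsBregmanPath

/-- The Bregman distance from `g₀` to the iterate with dual variable `z`, augmented by the
quadratic term. -/
noncomputable def potential (g₀ : ι → ℝ) (κ : ℝ) (z g : ι → ℝ) : ℝ :=
  ∑ i, (|g₀ i| - g₀ i * (z i - g i / κ)) + (g - g₀) ⬝ᵥ (g - g₀) / (2 * κ)

namespace IsBregmanPath

variable {A : Matrix ρ ι ℝ} {g₀ : ι → ℝ} {κ Δt r c : ℝ} {z g : ℕ → ι → ℝ}

theorem sub_div_eq (hp : IsBregmanPath A g₀ κ Δt z g) (hκ : 0 < κ) (k : ℕ) (i : ι) :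
    z k i - g k i / κ = z k i - shrink (z k i) := by
  rw [hp.g_eq, mul_div_cancel_left₀ _ hκ.ne']

theorem potential_succ_le (hp : IsBregmanPath A g₀ κ Δt z g) (hκ : 0 < κ) (hΔt : 0 < Δt)
    (hr : ∀ u, (Aᵀ *ᵥ u) ⬝ᵥ (Aᵀ *ᵥ u) ≤ r * (u ⬝ᵥ u))
    (hc : ∀ v, c * (v ⬝ᵥ v) ≤ (A *ᵥ v) ⬝ᵥ (A *ᵥ v))
    (hstep : κ * Δt * r ≤ 2) (k : ℕ) :
    potential g₀ κ (z (k + 1)) (g (k + 1))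
      ≤ potential g₀ κ (z k) (g k)
        - c * (1 - κ * Δt * r / 2) * Δt * ((g k - g₀) ⬝ᵥ (g k - g₀)) := by
  set d := g k - g₀ with hd
  set dz := z (k + 1) - z k with hdz
  have h1 : dz ⬝ᵥ d = -(Δt * ((A *ᵥ d) ⬝ᵥ (A *ᵥ d))) := by
    have := hp.transpose_mulVec_residual k
    rw [← hdz, ← hd] at this
    rw [← neg_eq_iff_eq_neg, ← neg_dotProduct, ← this, smul_dotProduct,
      transpose_mulVec_dotProduct, smul_eq_mul]
  have h2 : dz ⬝ᵥ dz ≤ Δt ^ 2 * (r * ((A *ᵥ d) ⬝ᵥ (A *ᵥ d))) := by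
    have := hp.transpose_mulVec_residual k
    rw [← hdz, ← hd] at this
    rw [← neg_dotProduct_neg, ← this, smul_dotProduct, dotProduct_smul, smul_eq_mul, smul_eq_mul,
      ← mul_assoc, ← sq]
    exact mul_le_mul_of_nonneg_left (hr _) (sq_nonneg _)
  -- Coordinatewise this is `κ` times `shrink_potential_le`: all terms containing `g₀` cancel.
  have h3 : potential g₀ κ (z (k + 1)) (g (k + 1)) - potential g₀ κ (z k) (g k)
      ≤ dz ⬝ᵥ d + κ / 2 * (dz ⬝ᵥ dz) := by
    simp only [potential, dotProduct, Finset.sum_div, Finset.mul_sum]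
    rw [← Finset.sum_add_distrib, ← Finset.sum_add_distrib, ← Finset.sum_add_distrib,
      ← Finset.sum_sub_distrib]
    refine Finset.sum_le_sum fun i _ => ?_
    rw [hp.sub_div_eq hκ, hp.sub_div_eq hκ]
    simp only [hdz, hd, Pi.sub_apply, hp.g_eq]
    have h4 := mul_le_mul_of_nonneg_left (shrink_potential_le (z k i) (z (k + 1) i)) hκ.le
    field_simp
    nlinarith
  have h5 := hc d
  have h6 : Δt * (1 - κ * Δt * r / 2) * (c * (d ⬝ᵥ d))
      ≤ Δt * (1 - κ * Δt * r / 2) * ((A *ᵥ d) ⬝ᵥ (A *ᵥ d)) :=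
    mul_le_mul_of_nonneg_left h5 (mul_nonneg hΔt.le (by linarith))
  have h7 := mul_le_mul_of_nonneg_left h2 (by positivity : 0 ≤ κ / 2)
  nlinarith

end IsBregmanPath
end LBI

namespace LBI

/-! ### A discrete Bihari inequality -/

section Bihari

variable {Φ x : ℕ → ℝ} {F T : ℝ → ℝ} {b μ : ℝ}

theorem antitone_of_decrease (hμ : 0 ≤ μ) (hx0 : ∀ k, 0 ≤ x k)
    (hdec : ∀ k, Φ (k + 1) ≤ Φ k - μ * x k) : Antitone Φ :=
  antitone_nat_of_succ_le fun k => (hdec k).trans (by linarith [mul_nonneg hμ (hx0 k)])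

theorem le_sub_of_decrease (hμ : 0 ≤ μ) (hdec : ∀ k, Φ (k + 1) ≤ Φ k - μ * x k) (K N : ℕ)
    (hb : ∀ k, k < K + N → b ≤ x k) : Φ (K + N) ≤ Φ K - N * (μ * b) := by
  induction N with
  | zero => simp
  | succ N ih =>
    have h1 := ih fun k hk => hb k (by omega)
    have h2 := hdec (K + N)
    have h3 := mul_le_mul_of_nonneg_left (hb (K + N) (by omega)) hμ
    rw [← add_assoc]
    push_cast
    linarith

/-- `T` plays the role of an antiderivative of `F' / y`. With `y k` the preimage of `Φ k` under `F`,
one has `y k ≤ x k`, so each step lowers `T (y k)` by at least `μ`; `T` cannot fall from `T (x 0)`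
to below `T b` as long as `Φ` stays above `F b`. -/
theorem discrete_bihari (hb : 0 < b) (hμ : 0 ≤ μ) (hF : Continuous F)
    (hmono : StrictMonoOn F (Set.Ici 0))
    (hT : ∀ y' y, b ≤ y' → y' ≤ y → F y - F y' ≤ y * (T y - T y'))
    (hx0 : ∀ k, 0 ≤ x k) (hx : ∀ k, Φ k ≤ F (x k)) (hdec : ∀ k, Φ (k + 1) ≤ Φ k - μ * x k)
    {K : ℕ} (hK : T (x 0) - T b < K * μ) : Φ K ≤ F b := by
  by_contra! hcon
  have hanti := antitone_of_decrease hμ hx0 hdec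
  have hbig : ∀ k, k ≤ K → F b < Φ k := fun k hk => hcon.trans_le (hanti hk)
  have hTmono : ∀ y' y, b ≤ y' → y' ≤ y → T y' ≤ T y := by
    intro y' y h1 h2
    have h3 := hT y' y h1 h2
    have h4 : F y' ≤ F y := hmono.monotoneOn (by simp; linarith) (by simp; linarith) h2
    have h5 : 0 ≤ y * (T y - T y') := by linarith
    have := nonneg_of_mul_nonneg_right h5 (by linarith)
    linarith
  have hex : ∀ k, k ≤ K → ∃ y, b ≤ y ∧ y ≤ x k ∧ F y = Φ k := by
    intro k hk
    have h1 : F b < F (x k) := (hbig k hk).trans_le (hx k)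
    have h2 : b < x k := (hmono.lt_iff_lt (by simpa using hb.le) (hx0 k)).1 h1
    obtain ⟨y, hy, hy'⟩ := intermediate_value_Icc h2.le hF.continuousOn ⟨(hbig k hk).le, hx k⟩
    exact ⟨y, hy.1, hy.2, hy'⟩
  choose! y hyb hyx hyF using hex
  have hsum : ∀ k, k ≤ K → k * μ ≤ T (y 0) - T (y k) := by
    intro k
    induction k with
    | zero => simp
    | succ k ih =>
      intro hk
      have h1 := ih (by omega)
      have hyk := hyb k (by omega)
      have h2 : y (k + 1) ≤ y k := by
        have h3 : F (y (k + 1)) ≤ F (y k) := by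
          rw [hyF _ hk, hyF _ (by omega)]
          exact hanti (by omega)
        exact (hmono.le_iff_le (hb.le.trans (hyb _ hk)) (hb.le.trans hyk)).1 h3
      have h4 := hT _ _ (hyb _ hk) h2
      rw [hyF _ hk, hyF _ (by omega)] at h4
      have h5 := mul_le_mul_of_nonneg_left (hyx k (by omega)) hμ
      have h6 : y k * μ ≤ y k * (T (y k) - T (y (k + 1))) := by
        have := hdec k
        linarith
      have h7 := le_of_mul_le_mul_left h6 (by linarith)
      push_cast
      linarith
  have h1 := hsum K le_rfl
  have h2 := hTmono _ _ le_rfl (hyb K le_rfl)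
  have h3 := hTmono _ _ (hyb 0 (by omega)) (hyx 0 (by omega))
  linarith

end Bihari

/-! ### Bounds on the potential -/

variable {ρ ι : Type*} [Fintype ρ] [Fintype ι]

namespace IsBregmanPath

variable {A : Matrix ρ ι ℝ} {g₀ : ι → ℝ} {κ Δt : ℝ} {z g : ℕ → ι → ℝ}

theorem abs_clip_le (hp : IsBregmanPath A g₀ κ Δt z g) (hκ : 0 < κ) (k : ℕ) (i : ι) :
    |z k i - g k i / κ| ≤ 1 := by
  rw [hp.sub_div_eq hκ]
  exact abs_sub_shrink_le _

theorem distance_term_nonneg (hp : IsBregmanPath A g₀ κ Δt z g) (hκ : 0 < κ) (k : ℕ) (i : ι) :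
    0 ≤ |g₀ i| - g₀ i * (z k i - g k i / κ) := by
  have h1 : g₀ i * (z k i - g k i / κ) ≤ |g₀ i| := by
    refine (le_abs_self _).trans ?_
    rw [abs_mul]
    exact mul_le_of_le_one_right (abs_nonneg _) (hp.abs_clip_le hκ k i)
  linarith

theorem distance_term_le (hp : IsBregmanPath A g₀ κ Δt z g) (hκ : 0 < κ) (k : ℕ) (i : ι) :
    |g₀ i| - g₀ i * (z k i - g k i / κ) ≤ 2 * |g₀ i| := by
  have h1 : -(g₀ i * (z k i - g k i / κ)) ≤ |g₀ i| := by
    refine (neg_le_abs _).trans ?_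
    rw [abs_mul]
    exact mul_le_of_le_one_right (abs_nonneg _) (hp.abs_clip_le hκ k i)
  linarith

/-- Under the hypothesis a nonzero `g₀ i` has the sign of the iterate, and at a nonzero iterate the
clipped dual variable equals that sign. -/
theorem distance_term_eq_zero (hp : IsBregmanPath A g₀ κ Δt z g) (hκ : 0 < κ) {k : ℕ} {i : ι}
    (h : |g k i - g₀ i| < |g₀ i|) : |g₀ i| - g₀ i * (z k i - g k i / κ) = 0 := by
  rw [hp.sub_div_eq hκ]
  have hg := hp.g_eq k i
  have hs := shrink_mul_sub_shrink (z k i)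
  set u := shrink (z k i) with hu
  set c := z k i - u with hc
  rcases lt_trichotomy (g₀ i) 0 with h0 | h0 | h0
  · rw [abs_of_neg h0] at h ⊢
    have h1 : g k i < 0 := by linarith [(abs_lt.1 h).2]
    have h2 : u < 0 := by
      by_contra! h3
      nlinarith [mul_nonneg hκ.le h3]
    rw [abs_of_neg h2] at hs
    have : c = -1 := mul_left_cancel₀ h2.ne (by linarith)
    rw [this]; ring
  · simp [h0]
  · rw [abs_of_pos h0] at h ⊢
    have h1 : 0 < g k i := by linarith [(abs_lt.1 h).1]
    have h2 : 0 < u := by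
      by_contra! h3
      nlinarith [mul_nonpos_of_nonneg_of_nonpos hκ.le h3]
    rw [abs_of_pos h2] at hs
    have : c = 1 := mul_left_cancel₀ h2.ne' (by linarith)
    rw [this]; ring

theorem div_le_potential (hp : IsBregmanPath A g₀ κ Δt z g) (hκ : 0 < κ) (k : ℕ) :
    (g k - g₀) ⬝ᵥ (g k - g₀) / (2 * κ) ≤ potential g₀ κ (z k) (g k) :=
  le_add_of_nonneg_left (Finset.sum_nonneg fun i _ => hp.distance_term_nonneg hκ k i)

theorem potential_le_sqrt (hp : IsBregmanPath A g₀ κ Δt z g) (hκ : 0 < κ) (k : ℕ) :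
    potential g₀ κ (z k) (g k) ≤ (g k - g₀) ⬝ᵥ (g k - g₀) / (2 * κ)
      + 2 * √(Fintype.card ι * ((g k - g₀) ⬝ᵥ (g k - g₀))) := by
  rw [potential, add_comm]
  gcongr
  have h1 : ∑ i, (|g₀ i| - g₀ i * (z k i - g k i / κ)) ≤ 2 * ∑ i, |g k i - g₀ i| := by
    rw [Finset.mul_sum]
    refine Finset.sum_le_sum fun i _ => ?_
    -- In the second case the error dominates `|g₀ i|`, hence also half the bound on the Bregman
    -- term.
    by_cases h : |g k i - g₀ i| < |g₀ i|
    · rw [hp.distance_term_eq_zero hκ h]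
      positivity
    · exact (hp.distance_term_le hκ k i).trans (by linarith)
  refine h1.trans ?_
  gcongr
  refine Real.le_sqrt_of_sq_le ?_
  have h2 := sq_sum_le_card_mul_sum_sq (s := Finset.univ) (f := fun i => |g k i - g₀ i|)
  simpa [dotProduct, sq_abs, ← sq] using h2

variable {a : ℝ}

theorem potential_le_linear (hp : IsBregmanPath A g₀ κ Δt z g) (hκ : 0 < κ) (ha : 0 < a)
    (hmin : ∀ i, a ≤ |g₀ i|) (k : ℕ) :
    potential g₀ κ (z k) (g k) ≤ (g k - g₀) ⬝ᵥ (g k - g₀) / (2 * κ)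
      + 2 * ((g k - g₀) ⬝ᵥ (g k - g₀)) / a := by
  rw [potential, add_comm]
  gcongr
  rw [dotProduct, Finset.mul_sum, Finset.sum_div]
  refine Finset.sum_le_sum fun i _ => ?_
  simp only [Pi.sub_apply]
  by_cases h : |g k i - g₀ i| < |g₀ i|
  · rw [hp.distance_term_eq_zero hκ h]
    exact div_nonneg (mul_nonneg zero_le_two (mul_self_nonneg _)) ha.le
  · refine (hp.distance_term_le hκ k i).trans ?_
    rw [le_div_iff₀ ha]
    have h1 := hmin i
    push Not at h
    rw [← abs_mul_abs_self (g k i - g₀ i)]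
    nlinarith [abs_nonneg (g₀ i)]

theorem abs_sub_lt_of_lt (hmin : ∀ i, a ≤ |g₀ i|) (ha : 0 < a) {k : ℕ}
    (h : (g k - g₀) ⬝ᵥ (g k - g₀) < a ^ 2) (i : ι) : |g k i - g₀ i| < |g₀ i| := by
  refine lt_of_lt_of_le ?_ (hmin i)
  refine abs_lt_of_sq_lt_sq ?_ ha.le
  refine lt_of_le_of_lt ?_ h
  have := Finset.single_le_sum (f := fun i => (g k - g₀) i * (g k - g₀) i)
    (fun i _ => mul_self_nonneg _) (Finset.mem_univ i)
  simpa [dotProduct, sq] using this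

theorem potential_eq_of_lt (hp : IsBregmanPath A g₀ κ Δt z g) (hκ : 0 < κ) (ha : 0 < a)
    (hmin : ∀ i, a ≤ |g₀ i|) {k : ℕ} (h : (g k - g₀) ⬝ᵥ (g k - g₀) < a ^ 2) :
    potential g₀ κ (z k) (g k) = (g k - g₀) ⬝ᵥ (g k - g₀) / (2 * κ) := by
  rw [potential, Finset.sum_eq_zero, zero_add]
  exact fun i _ => hp.distance_term_eq_zero hκ (abs_sub_lt_of_lt hmin ha h i)

end IsBregmanPath

theorem sign_eq_of_abs_sub_lt {x y : ℝ} (h : |x - y| < |y|) :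
    SignType.sign x = SignType.sign y := by
  rcases lt_trichotomy y 0 with h0 | h0 | h0
  · rw [abs_of_neg h0] at h
    rw [sign_neg h0, sign_neg (by linarith [(abs_lt.1 h).2])]
  · rw [h0, abs_zero] at h
    exact absurd h (abs_nonneg _).not_gt
  · rw [abs_of_pos h0] at h
    rw [sign_pos h0, sign_pos (by linarith [(abs_lt.1 h).1])]

/-! ### The time to reach a given accuracy -/

/-- An antiderivative of `u ↦ (min u √u)' / u`. -/
noncomputable def biharTime (u : ℝ) : ℝ := if u ≤ 1 then Real.log u else 1 - 1 / √u

theorem biharTime_le_one (u : ℝ) (hu : 0 ≤ u) : biharTime u ≤ 1 := by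
  unfold biharTime
  split_ifs with h
  · exact (Real.log_nonpos hu h).trans zero_le_one
  · simp

theorem sub_le_mul_log_sub {u v : ℝ} (hv : 0 < v) (hvu : v ≤ u) :
    u - v ≤ u * (Real.log u - Real.log v) := by
  have hu : 0 < u := hv.trans_le hvu
  have h1 := Real.log_le_sub_one_of_pos (div_pos hv hu)
  rw [Real.log_div hv.ne' hu.ne'] at h1
  have h2 : u * (Real.log v - Real.log u) ≤ u * (v / u - 1) := by gcongr
  rw [mul_sub u (v / u), mul_div_cancel₀ _ hu.ne'] at h2
  linarith

theorem sqrt_sub_sqrt_le {u v : ℝ} (hv : 0 < v) (hvu : v ≤ u) :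
    √u - √v ≤ u * (1 / √v - 1 / √u) := by
  have hu : 0 < u := hv.trans_le hvu
  have h1 : 0 < √v := Real.sqrt_pos.2 hv
  have h2 : √v ≤ √u := Real.sqrt_le_sqrt hvu
  have h3 : u = √u * √u := (Real.mul_self_sqrt hu.le).symm
  have h4 : 0 < √u := h1.trans_le h2
  have h5 : u * (1 / √v - 1 / √u) = √u / √v * (√u - √v) := by
    nth_rewrite 1 [h3]
    field_simp
  rw [h5]
  have h6 : 1 ≤ √u / √v := (one_le_div h1).2 h2
  nlinarith

theorem min_sqrt_sub_le {u v : ℝ} (hv : 0 < v) (hvu : v ≤ u) :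
    min u (√u) - min v (√v) ≤ u * (biharTime u - biharTime v) := by
  have hlow : ∀ {w : ℝ}, 0 < w → w ≤ 1 → min w (√w) = w := fun {w} h0 h1 =>
    min_eq_left (Real.le_sqrt_of_sq_le (by nlinarith))
  have hhigh : ∀ {w : ℝ}, 1 ≤ w → min w (√w) = √w := fun {w} h1 =>
    min_eq_right (Real.sqrt_le_iff.2 ⟨by linarith, by nlinarith⟩)
  have hu : 0 < u := hv.trans_le hvu
  unfold biharTime
  by_cases h1 : u ≤ 1
  · rw [if_pos h1, if_pos (hvu.trans h1), hlow hu h1, hlow hv (hvu.trans h1)]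
    exact sub_le_mul_log_sub hv hvu
  · push Not at h1
    rw [if_neg h1.not_ge, hhigh h1.le]
    -- Across the breakpoint the two increments are chained through `1`; replacing the factor `1` by
    -- `u > 1` only enlarges the logarithmic one.
    by_cases h2 : v ≤ 1
    · rw [if_pos h2, hlow hv h2]
      have h3 := sqrt_sub_sqrt_le one_pos h1.le
      have h4 := sub_le_mul_log_sub hv h2
      have h5 := Real.log_nonpos hv.le h2
      simp only [Real.sqrt_one, Real.log_one] at h3 h4
      nlinarith
    · rw [if_neg h2, hhigh (not_le.1 h2).le]
      have := sqrt_sub_sqrt_le hv hvu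
      linarith

end LBI

/-! ### Hitting times of the restricted iteration. -/

namespace LBI

/-- Rounds a continuous time up to a whole number of steps; each use costs one `Δt` in the
conditions on the stopping time. -/
theorem exists_nat_mul_between {p μ : ℝ} (hp : 0 ≤ p) (hμ : 0 < μ) :
    ∃ K : ℕ, p < K * μ ∧ K * μ ≤ p + μ := by
  refine ⟨⌊p / μ⌋₊ + 1, ?_, ?_⟩
  · have := Nat.lt_floor_add_one (p / μ)
    rw [div_lt_iff₀ hμ] at this
    exact_mod_cast this
  · have := Nat.floor_le (div_nonneg hp hμ.le)
    rw [le_div_iff₀ hμ] at this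
    push_cast
    linarith

variable {ρ ι : Type*} [Fintype ρ] [Fintype ι]

namespace IsBregmanPath

variable {A : Matrix ρ ι ℝ} {g₀ : ι → ℝ} {κ Δt lam a : ℝ} {z g : ℕ → ι → ℝ}

/-- There are two phases. The Bihari inequality brings the potential down to `F (a²)`, at most `a² /
(2κ) + 2a`. A further time `2 / a` removes the excess `2a`: either the squared error stays above
`a²`, or it drops below, where the Bregman part is zero. Monotonicity of the potential then covers
all later times. -/
theorem dist_lt_min (hp : IsBregmanPath A g₀ κ Δt z g) [Nonempty ι] (hκ : 0 < κ) (hΔt : 0 < Δt)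
    (hlam : 0 < lam)
    (hdec : ∀ k, potential g₀ κ (z (k + 1)) (g (k + 1))
      ≤ potential g₀ κ (z k) (g k) - lam * Δt * ((g k - g₀) ⬝ᵥ (g k - g₀)))
    (ha : 0 < a) (hmin : ∀ i, a ≤ |g₀ i|) {k : ℕ}
    (hk : 1 / (2 * κ) * Real.log ((g₀ ⬝ᵥ g₀) / a ^ 2)
      + (4 + 2 * Real.log (Fintype.card ι)) / a + 2 * (lam * Δt) ≤ k * (lam * Δt)) :
    (g k - g₀) ⬝ᵥ (g k - g₀) < a ^ 2 := by
  set s : ℝ := (Fintype.card ι : ℝ) with hs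
  have hs1 : 1 ≤ s := by
    rw [hs]; exact_mod_cast Fintype.card_pos (α := ι)
  have hs0 : 0 < s := by linarith
  set μ := lam * Δt with hμ
  have hμ0 : 0 < μ := mul_pos hlam hΔt
  set Φ : ℕ → ℝ := fun k => potential g₀ κ (z k) (g k) with hΦ
  set x : ℕ → ℝ := fun k => (g k - g₀) ⬝ᵥ (g k - g₀) with hxdef
  have hx0 : ∀ k, 0 ≤ x k := fun k => dotProduct_self_nonneg' _
  have hG : x 0 = g₀ ⬝ᵥ g₀ := by simp [hxdef, hp.g_zero]
  have hGa : a ^ 2 ≤ x 0 := by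
    rw [hG]
    obtain ⟨i⟩ := ‹Nonempty ι›
    refine le_trans ?_ (Finset.single_le_sum (f := fun i => g₀ i * g₀ i)
      (fun i _ => mul_self_nonneg _) (Finset.mem_univ i))
    nlinarith [hmin i, abs_mul_abs_self (g₀ i)]
  have hanti : Antitone Φ := antitone_of_decrease hμ0.le hx0 hdec
  have hsa : 0 < s * a ^ 2 := by positivity
  -- This is `y / (2κ)` plus the minimum of `2y / a` and `2√(s y)`, rescaled so that the crossover
  -- `y = s a²` sits at `1`. The linear branch, used from `a²` to `s a²`, produces `log s`.
  set F : ℝ → ℝ := fun y => y / (2 * κ)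
    + 2 * s * a * min (y / (s * a ^ 2)) (√(y / (s * a ^ 2))) with hF
  set T : ℝ → ℝ := fun y => Real.log y / (2 * κ) + 2 / a * biharTime (y / (s * a ^ 2)) with hT
  have hFc : Continuous F := by fun_prop
  have hFm : StrictMonoOn F (Set.Ici 0) := by
    intro u _ v _ huv
    have : min (u / (s * a ^ 2)) (√(u / (s * a ^ 2)))
        ≤ min (v / (s * a ^ 2)) (√(v / (s * a ^ 2))) := by gcongr
    simp only [hF]
    exact add_lt_add_of_lt_of_le (by gcongr) (mul_le_mul_of_nonneg_left this (by positivity))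
  have hFx : ∀ k, Φ k ≤ F (x k) := by
    intro k
    have h1 := hp.potential_le_sqrt hκ k
    have h2 := hp.potential_le_linear hκ ha hmin k
    simp only [hF]
    rcases min_choice (x k / (s * a ^ 2)) (√(x k / (s * a ^ 2))) with h | h
    · rw [h]
      refine h2.trans (le_of_eq ?_)
      simp only [hxdef]
      field_simp
    · rw [h]
      refine h1.trans (le_of_eq ?_)
      congr 1
      have h3 : s * x k = (s * a) ^ 2 * (x k / (s * a ^ 2)) := by field_simp
      change 2 * √(s * x k) = _
      rw [h3, Real.sqrt_mul (by positivity), Real.sqrt_sq (by positivity)]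
      ring
  have hFT : ∀ y' y, a ^ 2 ≤ y' → y' ≤ y → F y - F y' ≤ y * (T y - T y') := by
    intro y' y h1 h2
    have hy' : 0 < y' := lt_of_lt_of_le (by positivity) h1
    have hy : 0 < y := hy'.trans_le h2
    have h3 := sub_le_mul_log_sub hy' h2
    have h4 := min_sqrt_sub_le (div_pos hy' hsa) (div_le_div_of_nonneg_right h2 hsa.le)
    have h5 := mul_le_mul_of_nonneg_left h3 (by positivity : 0 ≤ 1 / (2 * κ))
    have h6 := mul_le_mul_of_nonneg_left h4 (by positivity : 0 ≤ 2 * s * a)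
    have h7 : 2 * s * a * (y / (s * a ^ 2) * (biharTime (y / (s * a ^ 2))
        - biharTime (y' / (s * a ^ 2)))) = y * (2 / a * biharTime (y / (s * a ^ 2))
        - 2 / a * biharTime (y' / (s * a ^ 2))) := by field_simp
    simp only [hF, hT]
    rw [h7] at h6
    have h8 : 1 / (2 * κ) * (y * (Real.log y - Real.log y'))
      = y * (Real.log y / (2 * κ) - Real.log y' / (2 * κ)) := by ring
    rw [h8] at h5
    have h9 : 1 / (2 * κ) * (y - y') = y / (2 * κ) - y' / (2 * κ) := by ring
    linarith
  have hFb : F (a ^ 2) ≤ a ^ 2 / (2 * κ) + 2 * a := by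
    simp only [hF]
    refine (add_le_add_iff_left _).2 ?_
    calc 2 * s * a * min (a ^ 2 / (s * a ^ 2)) (√(a ^ 2 / (s * a ^ 2)))
        ≤ 2 * s * a * (a ^ 2 / (s * a ^ 2)) := by gcongr; exact min_le_left _ _
      _ = 2 * a := by field_simp
  set p := 1 / (2 * κ) * Real.log ((g₀ ⬝ᵥ g₀) / a ^ 2) + (2 + 2 * Real.log s) / a with hp'
  have hlogs : 0 ≤ Real.log s := Real.log_nonneg hs1
  have hp0 : 0 ≤ p := by
    have : 0 ≤ Real.log ((g₀ ⬝ᵥ g₀) / a ^ 2) :=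
      Real.log_nonneg ((one_le_div (by positivity)).2 (hG ▸ hGa))
    positivity
  have hTp : T (x 0) - T (a ^ 2) ≤ p := by
    have h1 : biharTime (a ^ 2 / (s * a ^ 2)) = -Real.log s := by
      have : a ^ 2 / (s * a ^ 2) = s⁻¹ := by field_simp
      rw [this, biharTime, if_pos (inv_le_one_of_one_le₀ hs1), Real.log_inv]
    have h2 := biharTime_le_one (x 0 / (s * a ^ 2)) (div_nonneg (hx0 0) hsa.le)
    have h3 : 2 / a * biharTime (x 0 / (s * a ^ 2)) ≤ 2 / a * 1 := by gcongr
    simp only [hT, h1, hp', ← hG]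
    rw [Real.log_div (by nlinarith [sq_pos_of_pos ha]) (by positivity)]
    have h4 : (2 + 2 * Real.log s) / a = 2 / a * 1 - 2 / a * -Real.log s := by ring
    rw [h4]
    have h5 : 1 / (2 * κ) * (Real.log (x 0) - Real.log (a ^ 2))
      = Real.log (x 0) / (2 * κ) - Real.log (a ^ 2) / (2 * κ) := by ring
    linarith
  obtain ⟨K, hK1, hK2⟩ := exists_nat_mul_between hp0 hμ0
  obtain ⟨N, hN1, hN2⟩ := exists_nat_mul_between (by positivity : 0 ≤ 2 / a) hμ0
  have hKN : K + N ≤ k := by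
    have h1 : ((K : ℝ) + N) * μ ≤ k * μ := by
      have : (4 + 2 * Real.log s) / a = (2 + 2 * Real.log s) / a + 2 / a := by ring
      linarith
    exact_mod_cast le_of_mul_le_mul_right h1 hμ0
  have hΦK : Φ K ≤ F (a ^ 2) := discrete_bihari (by positivity) hμ0.le hFc hFm hFT hx0 hFx hdec
    (hTp.trans_lt hK1)
  have hend : Φ (K + N) < a ^ 2 / (2 * κ) := by
    by_contra! hcon
    have hxa : ∀ j, j < K + N → a ^ 2 ≤ x j := by
      intro j hj
      by_contra! hlt
      have h1 : Φ j = x j / (2 * κ) := hp.potential_eq_of_lt hκ ha hmin hlt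
      have h2 : x j / (2 * κ) < a ^ 2 / (2 * κ) := by gcongr
      have h3 := hanti hj.le
      linarith
    have h1 := le_sub_of_decrease (Φ := Φ) (x := x) hμ0.le hdec K N hxa
    have h2 : 2 * a < N * (μ * a ^ 2) := by
      have := mul_lt_mul_of_pos_right hN1 (by positivity : 0 < a ^ 2)
      have h3 : 2 / a * a ^ 2 = 2 * a := by field_simp
      linarith
    change Φ (K + N) ≤ Φ K - _ at h1
    linarith
  have h1 : x k / (2 * κ) < a ^ 2 / (2 * κ) :=
    (hp.div_le_potential hκ k).trans_lt ((hanti hKN).trans_lt hend)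
  exact (div_lt_div_iff_of_pos_right (by positivity)).1 h1

theorem exists_dist_le (hp : IsBregmanPath A g₀ κ Δt z g) (hκ : 0 < κ) (hΔt : 0 < Δt)
    (hlam : 0 < lam)
    (hdec : ∀ k, potential g₀ κ (z (k + 1)) (g (k + 1))
      ≤ potential g₀ κ (z k) (g k) - lam * Δt * ((g k - g₀) ⬝ᵥ (g k - g₀)))
    (ha : 0 < a) (hGa : a ^ 2 ≤ g₀ ⬝ᵥ g₀) {K : ℕ}
    (hK : 1 / (2 * κ) * Real.log ((g₀ ⬝ᵥ g₀) / a ^ 2)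
      + 4 * √(Fintype.card ι) / a + lam * Δt ≤ K * (lam * Δt)) :
    ∃ k ≤ K, (g k - g₀) ⬝ᵥ (g k - g₀) ≤ a ^ 2 := by
  by_contra! hcon
  set s : ℝ := (Fintype.card ι : ℝ) with hs
  have hs0 : 0 ≤ s := by rw [hs]; positivity
  set μ := lam * Δt with hμ
  have hμ0 : 0 < μ := mul_pos hlam hΔt
  set Φ : ℕ → ℝ := fun k => potential g₀ κ (z k) (g k) with hΦ
  set x : ℕ → ℝ := fun k => (g k - g₀) ⬝ᵥ (g k - g₀) with hxdef
  have hx0 : ∀ k, 0 ≤ x k := fun k => dotProduct_self_nonneg' _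
  have hG : x 0 = g₀ ⬝ᵥ g₀ := by simp [hxdef, hp.g_zero]
  have hanti : Antitone Φ := antitone_of_decrease hμ0.le hx0 hdec
  set F : ℝ → ℝ := fun y => y / (2 * κ) + 2 * √(s * y) with hF
  set T : ℝ → ℝ := fun y => Real.log y / (2 * κ) - 2 * √s / √y with hT
  have hFc : Continuous F := by fun_prop
  have hFm : StrictMonoOn F (Set.Ici 0) := by
    intro u _ v _ huv
    simp only [hF]
    exact add_lt_add_of_lt_of_le (by gcongr) (by gcongr)
  have hFT : ∀ y' y, a ^ 2 ≤ y' → y' ≤ y → F y - F y' ≤ y * (T y - T y') := by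
    intro y' y h1 h2
    have hy' : 0 < y' := lt_of_lt_of_le (by positivity) h1
    have h3 := sub_le_mul_log_sub hy' h2
    have h4 := sqrt_sub_sqrt_le hy' h2
    have h5 := mul_le_mul_of_nonneg_left h3 (by positivity : 0 ≤ 1 / (2 * κ))
    have h6 := mul_le_mul_of_nonneg_left h4 (by positivity : 0 ≤ 2 * √s)
    simp only [hF, hT]
    rw [Real.sqrt_mul hs0, Real.sqrt_mul hs0]
    have h7 : y * (Real.log y / (2 * κ) - 2 * √s / √y - (Real.log y' / (2 * κ) - 2 * √s / √y'))
      = 1 / (2 * κ) * (y * (Real.log y - Real.log y'))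
        + 2 * √s * (y * (1 / √y' - 1 / √y)) := by ring
    have h8 : y / (2 * κ) + 2 * (√s * √y) - (y' / (2 * κ) + 2 * (√s * √y'))
      = 1 / (2 * κ) * (y - y') + 2 * √s * (√y - √y') := by ring
    rw [h7, h8]
    exact add_le_add h5 h6
  set p := 1 / (2 * κ) * Real.log ((g₀ ⬝ᵥ g₀) / a ^ 2) + 2 * √s / a with hp'
  have hp0 : 0 ≤ p := by
    have : 0 ≤ Real.log ((g₀ ⬝ᵥ g₀) / a ^ 2) :=
      Real.log_nonneg ((one_le_div (by positivity)).2 hGa)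
    positivity
  have hTp : T (x 0) - T (a ^ 2) ≤ p := by
    simp only [hT, hp', hG, Real.sqrt_sq ha.le]
    rw [Real.log_div (by nlinarith [sq_pos_of_pos ha]) (by positivity)]
    have h4 : 0 ≤ 2 * √s / √(g₀ ⬝ᵥ g₀) := by positivity
    have h5 : 1 / (2 * κ) * (Real.log (g₀ ⬝ᵥ g₀) - Real.log (a ^ 2))
      = Real.log (g₀ ⬝ᵥ g₀) / (2 * κ) - Real.log (a ^ 2) / (2 * κ) := by ring
    linarith
  obtain ⟨J, hJ1, hJ2⟩ := exists_nat_mul_between hp0 hμ0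
  have hJK : J ≤ K := by
    have h1 : (J : ℝ) * μ ≤ K * μ := by
      have : 4 * √s / a = 2 * √s / a + 2 * √s / a := by ring
      have : 0 ≤ 2 * √s / a := by positivity
      linarith
    exact_mod_cast le_of_mul_le_mul_right h1 hμ0
  obtain ⟨N, rfl⟩ := Nat.exists_eq_add_of_le hJK
  have hΦJ : Φ J ≤ F (a ^ 2) := discrete_bihari (by positivity) hμ0.le hFc hFm hFT hx0
    (hp.potential_le_sqrt hκ) hdec (hTp.trans_lt hJ1)
  -- If the error never falls to `a`, the remaining `N` steps remove the excess `2√s a` of `F (a²)`,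
  -- leaving a potential too small for the error at the last step.
  have h1 := le_sub_of_decrease (Φ := Φ) (x := x) hμ0.le hdec J N fun j hj => (hcon j hj.le).le
  have h2 : a ^ 2 / (2 * κ) < x (J + N) / (2 * κ) := by
    have := hcon (J + N) le_rfl
    simp only [hxdef]
    gcongr
  have h3 := hp.div_le_potential hκ (J + N)
  have h4 : F (a ^ 2) = a ^ 2 / (2 * κ) + 2 * √s * a := by
    simp only [hF]
    rw [Real.sqrt_mul hs0, Real.sqrt_sq ha.le]
    ring
  have h5 : 2 * √s / a ≤ N * μ := by
    push_cast at hK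
    have : 4 * √s / a = 2 * √s / a + 2 * √s / a := by ring
    linarith
  have h6 : 2 * √s * a ≤ N * (μ * a ^ 2) := by
    have := mul_le_mul_of_nonneg_right h5 (by positivity : 0 ≤ a ^ 2)
    have h7 : 2 * √s / a * a ^ 2 = 2 * √s * a := by field_simp
    linarith
  change Φ (J + N) ≤ Φ J - _ at h1
  change x (J + N) / (2 * κ) ≤ Φ (J + N) at h3
  linarith

end IsBregmanPath
end LBI

namespace LBI

/-! ### Gaussian tails -/

section Tails

open Filter Topology NNReal

theorem hasDerivAt_gaussianPDFReal (v : ℝ≥0) (hv : v ≠ 0) (x : ℝ) :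
    HasDerivAt (fun y => -(v * gaussianPDFReal 0 v y)) (x * gaussianPDFReal 0 v x) x := by
  have hv' : (v : ℝ) ≠ 0 := by exact_mod_cast hv
  unfold gaussianPDFReal
  have h1 : HasDerivAt (fun y : ℝ => -(y - 0) ^ 2 / (2 * v)) (-(x / v)) x := by
    have h2 : HasDerivAt (fun y : ℝ => -(y - 0) ^ 2 / (2 * v)) (-(2 * x) / (2 * v)) x := by
      simpa using ((hasDerivAt_pow 2 x).neg).div_const (2 * (v : ℝ))
    convert h2 using 1
    ring
  refine (((h1.exp).const_mul (√(2 * Real.pi * v))⁻¹).const_mul (v : ℝ)).neg.congr_deriv ?_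
  field_simp

theorem tendsto_gaussianPDFReal (v : ℝ≥0) (hv : v ≠ 0) :
    Tendsto (gaussianPDFReal 0 v) atTop (𝓝 0) := by
  have hv' : (0 : ℝ) < v := by exact_mod_cast pos_iff_ne_zero.2 hv
  have h1 : Tendsto (fun x : ℝ => -(x - 0) ^ 2 / (2 * v)) atTop atBot := by
    have h2 : Tendsto (fun x : ℝ => (x ^ 2) * (2 * (v : ℝ))⁻¹) atTop atTop :=
      (tendsto_pow_atTop two_ne_zero).atTop_mul_const (by positivity)
    refine (tendsto_neg_atTop_atBot.comp h2).congr fun x => ?_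
    simp only [Function.comp_apply, sub_zero]
    ring
  have h2 := (Real.tendsto_exp_atBot.comp h1).const_mul (√(2 * Real.pi * v))⁻¹
  rw [mul_zero] at h2
  exact h2

/-- Mills ratio: beyond `t` the density is at most `x / t` times itself, which has an explicit
antiderivative. -/
theorem gaussianReal_real_Ioi_le (v : ℝ≥0) (hv : v ≠ 0) {t : ℝ} (ht : 0 < t) :
    (gaussianReal 0 v).real (Set.Ioi t) ≤ v / t * gaussianPDFReal 0 v t := by
  have hv' : (0 : ℝ) < v := by exact_mod_cast pos_iff_ne_zero.2 hv
  have hlim : Tendsto (fun y => -(v * gaussianPDFReal 0 v y)) atTop (𝓝 0) := by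
    simpa using ((tendsto_gaussianPDFReal v hv).const_mul (v : ℝ)).neg
  have hpos : ∀ x ∈ Set.Ioi t, 0 ≤ x * gaussianPDFReal 0 v x := fun x hx =>
    mul_nonneg (ht.trans hx).le (gaussianPDFReal_nonneg _ _ _)
  have h1 := integral_Ioi_of_hasDerivAt_of_nonneg' (a := t)
    (fun x _ => hasDerivAt_gaussianPDFReal v hv x) hpos hlim
  have h2 := integrableOn_Ioi_deriv_of_nonneg' (a := t)
    (fun x _ => hasDerivAt_gaussianPDFReal v hv x) hpos hlim
  rw [measureReal_def, gaussianReal_apply_eq_integral _ hv, ENNReal.toReal_ofReal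
    (integral_nonneg fun x => gaussianPDFReal_nonneg _ _ _)]
  calc ∫ x in Set.Ioi t, gaussianPDFReal 0 v x
      ≤ ∫ x in Set.Ioi t, t⁻¹ * (x * gaussianPDFReal 0 v x) := by
        refine setIntegral_mono_on (integrable_gaussianPDFReal _ _).integrableOn
          (h2.const_mul _) measurableSet_Ioi fun x hx => ?_
        rw [← mul_assoc]
        refine le_mul_of_one_le_left (gaussianPDFReal_nonneg _ _ _) ?_
        rw [inv_mul_eq_div, one_le_div ht]
        exact (Set.mem_Ioi.1 hx).le
    _ = v / t * gaussianPDFReal 0 v t := by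
        rw [integral_const_mul, h1]
        ring

theorem gaussianReal_real_abs_le (v : ℝ≥0) {L : ℝ} (hL : 0 < L) :
    (gaussianReal 0 v).real {x | 2 * √v * √L < |x|} ≤ Real.exp (-(2 * L)) / (2 * √L) := by
  -- The degenerate law must be allowed, because a linear form with zero coefficients has it.
  by_cases hv : v = 0
  · subst hv
    rw [gaussianReal_zero_var, measureReal_def, Measure.dirac_apply' _
      (measurableSet_lt measurable_const (by fun_prop))]
    simp
    positivity
  have hv' : (0 : ℝ) < v := by exact_mod_cast pos_iff_ne_zero.2 hv
  set t := 2 * √(v : ℝ) * √L with ht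
  have hsv : 0 < √(v : ℝ) := Real.sqrt_pos.2 hv'
  have hsL : 0 < √L := Real.sqrt_pos.2 hL
  have ht0 : 0 < t := by positivity
  have h1 := gaussianReal_real_Ioi_le v hv ht0
  have h2 : (gaussianReal 0 v).real (Set.Iio (-t)) = (gaussianReal 0 v).real (Set.Ioi t) := by
    have h3 : (gaussianReal 0 v).map (fun x => -x) = gaussianReal 0 v := by
      rw [gaussianReal_map_neg, neg_zero]
    conv_lhs => rw [← h3]
    rw [map_measureReal_apply measurable_neg measurableSet_Iio]
    congr 1
    ext x
    simp
  have h3 : {x : ℝ | t < |x|} = Set.Ioi t ∪ Set.Iio (-t) := by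
    ext x
    simp [lt_abs, lt_neg]
  rw [h3]
  refine (measureReal_union_le _ _).trans ?_
  rw [h2]
  have h4 : v / t * gaussianPDFReal 0 v t = Real.exp (-(2 * L)) / (2 * √(2 * Real.pi) * √L) := by
    have h5 : -(t - 0) ^ 2 / (2 * v) = -(2 * L) := by
      rw [ht, sub_zero, mul_pow, mul_pow, Real.sq_sqrt hv'.le, Real.sq_sqrt hL.le]
      field_simp
    rw [gaussianPDFReal, h5, Real.sqrt_mul (by positivity), ht]
    have h6 : (v : ℝ) = √v * √v := (Real.mul_self_sqrt hv'.le).symm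
    nth_rewrite 1 [h6]
    field_simp
  have h5 : 2 ≤ √(2 * Real.pi) := Real.le_sqrt_of_sq_le (by nlinarith [Real.pi_gt_three])
  have h6 : v / t * gaussianPDFReal 0 v t ≤ Real.exp (-(2 * L)) / (2 * 2 * √L) := by
    rw [h4]
    gcongr
  calc _ ≤ Real.exp (-(2 * L)) / (2 * 2 * √L) + Real.exp (-(2 * L)) / (2 * 2 * √L) := by
        linarith
    _ = _ := by field_simp; norm_num

/-- The exponent `1 / (4v)` cancels half of the Gaussian exponent, so the variance doubles and the
normalization leaves `√2`. -/
theorem integral_exp_sq_gaussianReal {v : ℝ≥0} (hv : v ≠ 0) :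
    ∫ x, Real.exp (1 / (4 * v) * x ^ 2) ∂(gaussianReal 0 v) = √2 := by
  have hv' : (0 : ℝ) < v := by exact_mod_cast pos_iff_ne_zero.2 hv
  rw [integral_gaussianReal_eq_integral_smul hv]
  have h1 : ∀ x : ℝ, gaussianPDFReal 0 v x • Real.exp (1 / (4 * v) * x ^ 2)
      = (√(2 * Real.pi * v))⁻¹ * Real.exp (-(1 / (4 * v)) * x ^ 2) := by
    intro x
    rw [gaussianPDFReal, smul_eq_mul, mul_assoc, ← Real.exp_add]
    congr 2
    field_simp
    ring
  simp_rw [h1]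
  rw [integral_const_mul, integral_gaussian, inv_mul_eq_div, ← Real.sqrt_div' _ (by positivity)]
  congr 1
  field_simp
  norm_num

end Tails

/-! ### Linear forms of the noise -/

section Noise

open NNReal

variable {E Ω : Type*} [MeasurableSpace Ω] {P : Measure Ω} {ε : E → Ω → ℝ} {v : ℝ≥0}

theorem hasGaussianLaw_noise (hlaw : ∀ e, HasLaw (ε e) (gaussianReal 0 v) P) (e : E) :
    HasGaussianLaw (ε e) P := ⟨by rw [(hlaw e).map_eq]; infer_instance⟩

variable [Fintype E]

theorem hasGaussianLaw_linear {ι : Type*} [Fintype ι] (hindep : iIndepFun ε P)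
    (hlaw : ∀ e, HasLaw (ε e) (gaussianReal 0 v) P) (a : ι → E → ℝ) :
    HasGaussianLaw (fun ω i => a i ⬝ᵥ fun e => ε e ω) P := by
  have h := (hindep.hasGaussianLaw (hasGaussianLaw_noise hlaw)).map_fun
    (Matrix.of a).mulVecLin.toContinuousLinearMap
  exact h

theorem covariance_linear (hindep : iIndepFun ε P)
    (hlaw : ∀ e, HasLaw (ε e) (gaussianReal 0 v) P) (a b : E → ℝ) :
    cov[fun ω => a ⬝ᵥ fun e => ε e ω, fun ω => b ⬝ᵥ fun e => ε e ω; P] = v * (a ⬝ᵥ b) := by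
  classical
  have := hindep.isProbabilityMeasure
  have hm : ∀ e, MemLp (ε e) 2 P := fun e => (hasGaussianLaw_noise hlaw e).memLp_two
  have hcov : ∀ e e', cov[ε e, ε e'; P] = if e = e' then (v : ℝ) else 0 := by
    intro e e'
    split_ifs with h
    · subst h
      rw [covariance_self (hlaw e).aemeasurable, (hlaw e).variance_eq, variance_id_gaussianReal]
    · exact (hindep.indepFun h).covariance_eq_zero (hm e) (hm e')
  simp only [dotProduct]
  rw [covariance_fun_sum_fun_sum (fun e => (hm e).const_mul _) (fun e => (hm e).const_mul _)]
  simp only [covariance_const_mul_left, covariance_const_mul_right, hcov, mul_ite, mul_zero,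
    Finset.sum_ite_eq, Finset.mem_univ, if_true, Finset.mul_sum]
  exact Finset.sum_congr rfl fun e _ => by ring

theorem integral_linear (hlaw : ∀ e, HasLaw (ε e) (gaussianReal 0 v) P) (a : E → ℝ) :
    ∫ ω, (a ⬝ᵥ fun e => ε e ω) ∂P = 0 := by
  simp only [dotProduct]
  rw [integral_finsetSum]
  · refine Finset.sum_eq_zero fun e _ => ?_
    rw [integral_const_mul, (hlaw e).integral_eq, integral_id_gaussianReal, mul_zero]
  · exact fun e _ => ((hasGaussianLaw_noise hlaw e).integrable).const_mul _

theorem hasLaw_linear (hindep : iIndepFun ε P)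
    (hlaw : ∀ e, HasLaw (ε e) (gaussianReal 0 v) P) (a : E → ℝ) :
    HasLaw (fun ω => a ⬝ᵥ fun e => ε e ω) (gaussianReal 0 (v * (a ⬝ᵥ a)).toNNReal) P := by
  have h : HasGaussianLaw (fun ω => a ⬝ᵥ fun e => ε e ω) P := by
    have h1 := hasGaussianLaw_linear hindep hlaw (fun _ : Fin 1 => a)
    exact h1.eval 0
  refine ⟨h.aemeasurable, ?_⟩
  rw [h.map_eq_gaussianReal, integral_linear hlaw, ← covariance_self h.aemeasurable,
    covariance_linear hindep hlaw]

theorem measureReal_linear_le (hindep : iIndepFun ε P)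
    (hlaw : ∀ e, HasLaw (ε e) (gaussianReal 0 v) P) (a : E → ℝ) {L : ℝ} (hL : 0 < L) :
    P.real {ω | 2 * √(v * (a ⬝ᵥ a)) * √L < |a ⬝ᵥ fun e => ε e ω|}
      ≤ Real.exp (-(2 * L)) / (2 * √L) := by
  have h := (hasLaw_linear hindep hlaw a).measureReal_eq
    (p := fun x => 2 * √(v * (a ⬝ᵥ a)) * √L < |x|) (measurableSet_lt measurable_const (by fun_prop))
  rw [h]
  have h1 := gaussianReal_real_abs_le (v * (a ⬝ᵥ a)).toNNReal hL
  rwa [Real.coe_toNNReal _ (mul_nonneg v.coe_nonneg (dotProduct_self_nonneg' a))] at h1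

theorem measureReal_sum_sq_le {ι : Type*} [Fintype ι] [DecidableEq ι] (hindep : iIndepFun ε P)
    (hv : v ≠ 0) (hlaw : ∀ e, HasLaw (ε e) (gaussianReal 0 v) P) (b : ι → E → ℝ)
    (hb : ∀ i j, b i ⬝ᵥ b j = if i = j then 1 else 0) (x : ℝ) :
    P.real {ω | x ≤ ∑ i, (b i ⬝ᵥ fun e => ε e ω) ^ 2}
      ≤ Real.exp (-(1 / (4 * v)) * x) * √2 ^ Fintype.card ι := by
  have := hindep.isProbabilityMeasure
  set X : ι → Ω → ℝ := fun i ω => b i ⬝ᵥ fun e => ε e ω with hX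
  have hXind : iIndepFun X P := by
    refine (hasGaussianLaw_linear hindep hlaw b).iIndepFun_of_covariance_eq_zero fun i j hij => ?_
    rw [covariance_linear hindep hlaw, hb, if_neg hij, mul_zero]
  have hXlaw : ∀ i, HasLaw (X i) (gaussianReal 0 v) P := by
    intro i
    have := hasLaw_linear hindep hlaw (b i)
    rwa [hb, if_pos rfl, mul_one, Real.toNNReal_coe] at this
  set Z : ι → Ω → ℝ := fun i ω => X i ω ^ 2 with hZ
  have hZind : iIndepFun Z P := hXind.comp (fun _ y => y ^ 2) fun _ => by fun_prop
  have hZm : ∀ i, AEMeasurable (Z i) P := fun i => (hXlaw i).aemeasurable.pow_const 2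
  have hmgf : ∀ i, mgf (Z i) P (1 / (4 * v)) = √2 := by
    intro i
    rw [mgf, ← integral_exp_sq_gaussianReal hv]
    exact (hXlaw i).integral_comp (f := fun y => Real.exp (1 / (4 * v) * y ^ 2))
      (by fun_prop)
  have hsum := hZind.mgf_sum₀ (t := 1 / (4 * v)) hZm Finset.univ
  simp only [hmgf, Finset.prod_const, Finset.card_univ] at hsum
  have hint : Integrable (fun ω => Real.exp (1 / (4 * v) * (∑ i, Z i) ω)) P := by
    -- A nonintegrable function has integral `0` by convention, so a nonzero moment generating
    -- function forces integrability.
    refine not_imp_comm.1 integral_undef ?_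
    change mgf (∑ i, Z i) P (1 / (4 * v)) ≠ 0
    rw [hsum]
    positivity
  have h := measure_ge_le_exp_mul_mgf x (by positivity) hint
  rw [hsum] at h
  simpa only [Finset.sum_apply] using h

end Noise
end LBI

namespace LBI

/-! ### The event of high probability. -/

section Event

open NNReal

variable {E Ω : Type*} [Fintype E] [MeasurableSpace Ω] {P : Measure Ω} {ε : E → Ω → ℝ} {v : ℝ≥0}

/-- The noise is only almost everywhere measurable, so the bad set is enlarged to a measurable set
of equal measure before taking complements. -/
theorem exists_measurable_compl (P : Measure Ω) [IsProbabilityMeasure P] (B : Set Ω) {p : ℝ}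
    (hB : P.real B ≤ p) : ∃ A : Set Ω, MeasurableSet A ∧ 1 - p ≤ P.real A ∧ ∀ ω ∈ A, ω ∉ B := by
  refine ⟨(toMeasurable P B)ᶜ, (measurableSet_toMeasurable P B).compl, ?_, fun ω hω hB' =>
    hω (subset_toMeasurable P B hB')⟩
  rw [probReal_compl_eq_one_sub (measurableSet_toMeasurable P B)]
  have : P.real (toMeasurable P B) = P.real B := by
    rw [measureReal_def, measure_toMeasurable, ← measureReal_def]
  linarith

theorem exp_neg_two_log {m : ℕ} (hm : 2 ≤ m) : Real.exp (-(2 * Real.log m)) = 1 / (m : ℝ) ^ 2 := by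
  have hm0 : (0 : ℝ) < m := by positivity
  rw [Real.exp_neg, two_mul, Real.exp_add, Real.exp_log hm0, sq, one_div]

theorem measureReal_forall_linear_le [IsProbabilityMeasure P] (hindep : iIndepFun ε P)
    (hlaw : ∀ e, HasLaw (ε e) (gaussianReal 0 v) P) (hm : 2 ≤ Fintype.card E) (a : E → E → ℝ) :
    P.real {ω | ∃ e, 2 * √(v * (a e ⬝ᵥ a e)) * √(Real.log (Fintype.card E))
        < |a e ⬝ᵥ fun e => ε e ω|}
      ≤ 1 / (Fintype.card E * √(Real.log (Fintype.card E))) := by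
  set m := Fintype.card E with hmdef
  have hm0 : (0 : ℝ) < m := by positivity
  have hL : 0 < Real.log m := Real.log_pos (by exact_mod_cast hm)
  have hsL := Real.sqrt_pos.2 hL
  have h1 : {ω | ∃ e, 2 * √(v * (a e ⬝ᵥ a e)) * √(Real.log m) < |a e ⬝ᵥ fun e => ε e ω|}
      = ⋃ e, {ω | 2 * √(v * (a e ⬝ᵥ a e)) * √(Real.log m) < |a e ⬝ᵥ fun e => ε e ω|} := by
    ext ω; simp
  rw [h1]
  refine (measureReal_iUnion_fintype_le _).trans ?_
  refine (Finset.sum_le_sum fun e _ => measureReal_linear_le hindep hlaw (a e) hL).trans ?_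
  rw [Finset.sum_const, Finset.card_univ, nsmul_eq_mul, ← hmdef, exp_neg_two_log hm]
  have : (m : ℝ) * (1 / (m : ℝ) ^ 2 / (2 * √(Real.log m))) = 1 / (m * (2 * √(Real.log m))) := by
    field_simp
  rw [this]
  gcongr
  linarith

theorem measureReal_norm_orthonormal_le {ι : Type*} [Fintype ι] [DecidableEq ι]
    [IsProbabilityMeasure P] (hindep : iIndepFun ε P) (hv : v ≠ 0)
    (hlaw : ∀ e, HasLaw (ε e) (gaussianReal 0 v) P) (b : ι → E → ℝ)
    (hb : ∀ i j, b i ⬝ᵥ b j = if i = j then 1 else 0) {m l : ℕ} (hm : 2 ≤ m)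
    (hι : 1 ≤ Fintype.card ι) (hl : Fintype.card ι ≤ l) :
    P.real {ω | 2 * √v * (√(Real.log m) + Fintype.card ι * √(Real.log l))
        < √(∑ i, (b i ⬝ᵥ fun e => ε e ω) ^ 2)} ≤ 1 / (m * √(Real.log m)) := by
  have hm0 : (0 : ℝ) < m := by positivity
  have hm2 : (2 : ℝ) ≤ m := by exact_mod_cast hm
  have hL : 0 < Real.log m := Real.log_pos (by exact_mod_cast hm)
  have hsL := Real.sqrt_pos.2 hL
  set L := Real.log m with hLdef
  have hv' : (0 : ℝ) < v := by exact_mod_cast pos_iff_ne_zero.2 hv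
  -- For a single form `log l` may vanish, so the one-dimensional tail is used. Otherwise `l ≥ 2`,
  -- and in `(√L + s q)²` the term `(s q)²` absorbs the factor `√2 ^ s`, while the cross term is at
  -- least `√L` and supplies the factor `1 / √L`.
  rcases hι.eq_or_lt with h1 | h1
  · obtain ⟨i, hi⟩ := Fintype.card_eq_one_iff.1 h1.symm
    have huniv : (Finset.univ : Finset ι) = {i} := by
      ext j; simpa using hi j
    refine le_trans (measureReal_mono ?_) ((measureReal_linear_le hindep hlaw (b i) hL).trans ?_)
    · intro ω hω
      simp only [Set.mem_ofPred_eq, huniv, Finset.sum_singleton, Real.sqrt_sq_eq_abs, hb, if_true,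
        mul_one] at hω ⊢
      refine lt_of_le_of_lt ?_ hω
      gcongr
      exact le_add_of_nonneg_right (by positivity)
    · rw [exp_neg_two_log hm, div_div]
      gcongr
      · nlinarith
      · linarith
  · set s : ℝ := (Fintype.card ι : ℝ) with hs
    have hs1 : 1 ≤ s := by rw [hs]; exact_mod_cast hι
    have hl2 : (2 : ℝ) ≤ l := by exact_mod_cast (h1.trans_le hl)
    have hlog2 : 1 / 2 < Real.log 2 := by linarith [Real.log_two_gt_d9]
    have hlogl : Real.log 2 ≤ Real.log l := Real.log_le_log two_pos hl2
    set q := √(Real.log l) with hq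
    have hq2 : q ^ 2 = Real.log l := Real.sq_sqrt (by linarith)
    have hq1 : 1 / 2 ≤ q := Real.le_sqrt_of_sq_le (by norm_num; linarith)
    have hsL2 : √L ^ 2 = L := Real.sq_sqrt hL.le
    refine le_trans (measureReal_mono ?_) ((measureReal_sum_sq_le hindep hv hlaw b hb
      ((2 * √v * (√L + s * q)) ^ 2)).trans ?_)
    · intro ω hω
      exact ((Real.lt_sqrt (by positivity)).1 hω).le
    · have h2 : √2 ^ Fintype.card ι ≤ Real.exp (s * (Real.log 2 / 2)) := by
        rw [hs, Real.exp_nat_mul, ← Real.log_sqrt two_pos.le, Real.exp_log (by positivity)]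
      have h3 : -(1 / (4 * v)) * (2 * √v * (√L + s * q)) ^ 2 = -(√L + s * q) ^ 2 := by
        rw [mul_pow, mul_pow, Real.sq_sqrt hv'.le]
        field_simp
        norm_num
      rw [h3]
      calc Real.exp (-(√L + s * q) ^ 2) * √2 ^ Fintype.card ι
          ≤ Real.exp (-(√L + s * q) ^ 2) * Real.exp (s * (Real.log 2 / 2)) := by gcongr
        _ = Real.exp (-(√L + s * q) ^ 2 + s * (Real.log 2 / 2)) := (Real.exp_add _ _).symm
        _ ≤ Real.exp (-L + -√L) := by
          refine Real.exp_le_exp.2 ?_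
          have h4 : s * (Real.log 2 / 2) ≤ (s * q) ^ 2 := by
            rw [mul_pow, hq2]
            have : s ≤ s ^ 2 := by nlinarith
            calc s * (Real.log 2 / 2) ≤ s ^ 2 * Real.log l := by gcongr; linarith
              _ = _ := rfl
          have h5 : 1 / 2 ≤ s * q := by nlinarith
          nlinarith
        _ = Real.exp (-√L) / m := by
          rw [Real.exp_add, Real.exp_neg L, Real.exp_log hm0]
          ring
        _ ≤ (1 / √L) / m := by
          gcongr
          rw [Real.exp_neg, ← one_div]
          gcongr
          linarith [Real.add_one_le_exp (√L)]
        _ = 1 / (m * √L) := by field_simp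

theorem exists_noise_event {ι : Type*} [Fintype ι] [DecidableEq ι]
    [IsProbabilityMeasure P] (hindep : iIndepFun ε P) (hv : v ≠ 0)
    (hlaw : ∀ e, HasLaw (ε e) (gaussianReal 0 v) P) (a : E → E → ℝ) (b : ι → E → ℝ)
    (hb : ∀ i j, b i ⬝ᵥ b j = if i = j then 1 else 0) {n l : ℕ} (hn : 2 ≤ n)
    (hnm : n ≤ Fintype.card E)
    (hι : 1 ≤ Fintype.card ι) (hl : Fintype.card ι ≤ l) :
    ∃ A : Set Ω, MeasurableSet A ∧
      1 - 1 / (Fintype.card E * √(Real.log (Fintype.card E))) - 2 / (n * √(Real.log n))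
        ≤ P.real A ∧
      ∀ ω ∈ A, (∀ e, |a e ⬝ᵥ fun e => ε e ω|
          ≤ 2 * √(v * (a e ⬝ᵥ a e)) * √(Real.log (Fintype.card E))) ∧
        √(∑ i, (b i ⬝ᵥ fun e => ε e ω) ^ 2)
          ≤ 2 * √v * (√(Real.log (Fintype.card E)) + Fintype.card ι * √(Real.log l)) := by
  have h1 := measureReal_forall_linear_le hindep hlaw (hn.trans hnm) a
  have h2 := measureReal_norm_orthonormal_le hindep hv hlaw b hb (hn.trans hnm) hι hl
  have h3 : 1 / (Fintype.card E * √(Real.log (Fintype.card E))) ≤ 2 / (n * √(Real.log n)) := by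
    have hn0 : (0 : ℝ) < n := by positivity
    have hnm' : (n : ℝ) ≤ Fintype.card E := by exact_mod_cast hnm
    have hlog : 0 < Real.log n := Real.log_pos (by exact_mod_cast hn)
    gcongr
    norm_num
  obtain ⟨A, hA, hPA, hAB⟩ := exists_measurable_compl P _
    ((measureReal_union_le _ _).trans (add_le_add h1 (h2.trans h3)))
  refine ⟨A, hA, by linarith, fun ω hω => ?_⟩
  have := hAB ω hω
  simp only [Set.mem_union, Set.mem_ofPred_eq, not_or, not_exists, not_lt] at this
  exact this

end Event
end LBI

namespace LBI

variable {ρ ι : Type*} [Fintype ρ] [Fintype ι]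

/-! ### The iteration off the support -/

theorem exists_isBregmanPath (A : Matrix ρ ι ℝ) (g₀ : ι → ℝ) (κ Δt : ℝ) :
    ∃ z g, IsBregmanPath A g₀ κ Δt z g := by
  let sh : (ι → ℝ) → ι → ℝ := fun y i => κ * shrink (y i)
  let z : ℕ → ι → ℝ := fun k => Nat.rec 0 (fun _ y => y + Δt • (Aᵀ *ᵥ (A *ᵥ (g₀ - sh y)))) k
  exact ⟨z, fun k => sh (z k), rfl, fun _ => rfl, fun _ _ => rfl⟩

theorem abs_dotProduct_le_sqrt (u v : ι → ℝ) : |u ⬝ᵥ v| ≤ √(u ⬝ᵥ u) * √(v ⬝ᵥ v) := by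
  rw [← Real.sqrt_mul (dotProduct_self_nonneg' u)]
  exact Real.abs_le_sqrt (dotProduct_sq_le u v)

theorem sq_le_dotProduct_self (v : ι → ℝ) (i : ι) : v i ^ 2 ≤ v ⬝ᵥ v := by
  rw [sq]
  exact Finset.single_le_sum (f := fun i => v i * v i) (fun i _ => mul_self_nonneg _)
    (Finset.mem_univ i)

namespace IsBregmanPath

variable {A : Matrix ρ ι ℝ} {g₀ : ι → ℝ} {κ Δt r c : ℝ} {z g : ℕ → ι → ℝ}

/-- Each step changes `q ⬝ z` by `Δt` times the inner product of `A q` with the residual, whose norm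
never exceeds its initial value. -/
theorem abs_dotProduct_z_le (hp : IsBregmanPath A g₀ κ Δt z g) (hκ : 0 < κ) (hΔt : 0 < Δt)
    (hr0 : 0 ≤ r) (hr : ∀ u, (Aᵀ *ᵥ u) ⬝ᵥ (Aᵀ *ᵥ u) ≤ r * (u ⬝ᵥ u))
    (hstep : κ * Δt * r ≤ 2) (q : ι → ℝ) (k : ℕ) :
    |q ⬝ᵥ z k|
      ≤ k * Δt * (√((A *ᵥ q) ⬝ᵥ (A *ᵥ q)) * √((A *ᵥ g₀) ⬝ᵥ (A *ᵥ g₀))) := by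
  induction k with
  | zero => simp [hp.z_zero]
  | succ k ih =>
    have h1 : q ⬝ᵥ (Aᵀ *ᵥ (A *ᵥ (g₀ - g k))) = -((A *ᵥ q) ⬝ᵥ (A *ᵥ (g k - g₀))) := by
      rw [dotProduct_comm, transpose_mulVec_dotProduct, ← neg_sub (g k), Matrix.mulVec_neg,
        neg_dotProduct, dotProduct_comm]
    rw [hp.z_succ, dotProduct_add, dotProduct_smul, h1, smul_eq_mul]
    refine (abs_add_le _ _).trans ?_
    rw [abs_mul, abs_neg, abs_of_pos hΔt]
    have h2 : |(A *ᵥ q) ⬝ᵥ (A *ᵥ (g k - g₀))|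
        ≤ √((A *ᵥ q) ⬝ᵥ (A *ᵥ q)) * √((A *ᵥ g₀) ⬝ᵥ (A *ᵥ g₀)) := by
      refine (abs_dotProduct_le_sqrt _ _).trans ?_
      gcongr
      exact hp.residual_le hκ hΔt hr0 hr hstep k
    have h3 := mul_le_mul_of_nonneg_left h2 hΔt.le
    push_cast
    linarith

theorem abs_g_le (hp : IsBregmanPath A g₀ κ Δt z g) (hκ : 0 < κ) (hΔt : 0 < Δt)
    (hr0 : 0 ≤ r) (hr : ∀ u, (Aᵀ *ᵥ u) ⬝ᵥ (Aᵀ *ᵥ u) ≤ r * (u ⬝ᵥ u))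
    (hstep : κ * Δt * r ≤ 2) (hc0 : 0 ≤ c) (hc : ∀ v, c * (v ⬝ᵥ v) ≤ (A *ᵥ v) ⬝ᵥ (A *ᵥ v))
    (k : ℕ) (i : ι) :
    √c * |g k i| ≤ √c * |g₀ i| + √((A *ᵥ g₀) ⬝ᵥ (A *ᵥ g₀)) := by
  have h1 : √c * |(g k - g₀) i| ≤ √((A *ᵥ g₀) ⬝ᵥ (A *ᵥ g₀)) := by
    refine Real.le_sqrt_of_sq_le ?_
    rw [mul_pow, Real.sq_sqrt hc0, sq_abs]
    calc c * (g k - g₀) i ^ 2 ≤ c * ((g k - g₀) ⬝ᵥ (g k - g₀)) := by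
          gcongr
          exact sq_le_dotProduct_self _ i
      _ ≤ _ := (hc _).trans (hp.residual_le hκ hΔt hr0 hr hstep k)
  have h2 : |g k i| ≤ |g₀ i| + |(g k - g₀) i| := by
    have := abs_add_le (g₀ i) ((g k - g₀) i)
    simpa using this
  have h3 := mul_le_mul_of_nonneg_left h2 (Real.sqrt_nonneg c)
  linarith

theorem abs_z_le (hp : IsBregmanPath A g₀ κ Δt z g) (hκ : 0 < κ) (k : ℕ) (i : ι) :
    |z k i| ≤ 1 + |g k i| / κ := by
  have h1 := hp.abs_clip_le hκ k i
  have h2 := abs_add_le (z k i - g k i / κ) (g k i / κ)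
  rw [sub_add_cancel, abs_div, abs_of_pos hκ] at h2
  linarith

/-- Off the support the dual variable stays in `[-1, 1]`. Either the residual is so small that
this holds by the bound on the speed of the dual variable, or the residual is large enough for
the irrepresentability constant `η` to absorb the noise. -/
theorem abs_off_support_le (hp : IsBregmanPath A g₀ κ Δt z g) (hκ : 0 < κ) (hΔt : 0 < Δt)
    (hr0 : 0 ≤ r) (hr : ∀ u, (Aᵀ *ᵥ u) ⬝ᵥ (Aᵀ *ᵥ u) ≤ r * (u ⬝ᵥ u))
    (hstep : κ * Δt * r ≤ 2) (hc0 : 0 < c) (hc : ∀ v, c * (v ⬝ᵥ v) ≤ (A *ᵥ v) ⬝ᵥ (A *ᵥ v))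
    {η B D F M gmax x : ℝ} (hD : 0 < D) (hB0 : 0 ≤ B) (hgmax : 0 ≤ gmax)
    (hB : B ≤ κ * η)
    (hres : √((A *ᵥ g₀) ⬝ᵥ (A *ᵥ g₀)) ≤ F) (hBF : √c * gmax + F ≤ √c * B)
    (hg₀ : ∀ i, √c * |g₀ i| ≤ √c * gmax + D)
    {q : ι → ℝ} (hq1 : ∑ i, |q i| ≤ 1 - η) (hqM : √((A *ᵥ q) ⬝ᵥ (A *ᵥ q)) ≤ M)
    (hx : |x| ≤ M * D) {k : ℕ} (hk : k * Δt * (M * D) ≤ η - B / κ) :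
    |q ⬝ᵥ z k + k * Δt * x| ≤ 1 := by
  set L₀ := √((A *ᵥ g₀) ⬝ᵥ (A *ᵥ g₀)) with hL₀
  have hL₀0 : 0 ≤ L₀ := Real.sqrt_nonneg _
  set e := η - B / κ with he
  set t : ℝ := k * Δt with ht
  have ht0 : 0 ≤ t := by positivity
  have he0 : 0 ≤ e := by
    have : B / κ ≤ η := (div_le_iff₀' hκ).2 hB
    linarith
  have heη : e ≤ η := by
    have : 0 ≤ B / κ := by positivity
    linarith
  have htx : |t * x| ≤ t * (M * D) := by
    rw [abs_mul, abs_of_nonneg ht0]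
    gcongr
  refine (abs_add_le _ _).trans ?_
  -- In this case `t M (L₀ + D) ≤ 1`, and the bound linear in time suffices. Otherwise `D < e (L₀ +
  -- D) ≤ η R`, hence `(1 - η) R ≤ R - D ≤ √c B`, and the total is at most `(1 - η) + B / κ + e =
  -- 1`.
  by_cases hcase : e * (L₀ + D) ≤ D
  · have h1 := hp.abs_dotProduct_z_le hκ hΔt hr0 hr hstep q k
    have h2 : |q ⬝ᵥ z k| ≤ t * (M * L₀) := h1.trans (by gcongr)
    have h3 : t * M * (L₀ + D) ≤ 1 := by
      have h4 : t * (M * D) * (L₀ + D) ≤ e * (L₀ + D) := by gcongr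
      have h5 : t * M * (L₀ + D) * D ≤ 1 * D := by linarith
      exact le_of_mul_le_mul_right h5 hD
    linarith
  · push Not at hcase
    have hsc : 0 < √c := Real.sqrt_pos.2 hc0
    set R := √c * gmax + D + L₀ with hR
    have hgR : ∀ i, |g k i| ≤ R / √c := by
      intro i
      rw [le_div_iff₀' hsc]
      have := hp.abs_g_le hκ hΔt hr0 hr hstep hc0.le hc k i
      linarith [hg₀ i]
    have hR0 : 0 ≤ R := by positivity
    have h1 : |q ⬝ᵥ z k| ≤ (1 - η) * (1 + R / √c / κ) := by
      calc |q ⬝ᵥ z k| ≤ ∑ i, |q i * z k i| := Finset.abs_sum_le_sum_abs _ _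
        _ ≤ ∑ i, |q i| * (1 + R / √c / κ) := by
          refine Finset.sum_le_sum fun i _ => ?_
          rw [abs_mul]
          gcongr
          refine (hp.abs_z_le hκ k i).trans ?_
          gcongr
          exact hgR i
        _ = (∑ i, |q i|) * (1 + R / √c / κ) := by rw [Finset.sum_mul]
        _ ≤ _ := by gcongr
    have h2 : (1 - η) * (R / √c) ≤ B := by
      rw [← mul_div_assoc, div_le_iff₀ hsc]
      have h3 : D ≤ η * R := by
        have h4 : e * (L₀ + D) ≤ η * R := by
          have : 0 ≤ √c * gmax := by positivity
          exact mul_le_mul heη (by linarith) (by positivity) (by linarith)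
        linarith
      linarith
    have h3 : (1 - η) * (R / √c) / κ ≤ B / κ := by gcongr
    have h4 : (1 - η) * (1 + R / √c / κ) = (1 - η) + (1 - η) * (R / √c) / κ := by ring
    linarith

end IsBregmanPath

/-! ### From the restricted to the full iteration -/

section Full

variable {E : Type*} [Fintype E] {l : ℕ}

theorem mulVec_eq_cols_mulVec (Ψ : Matrix (Fin l) E ℝ) (S : Finset E) (x : E → ℝ)
    (hx : ∀ e, e ∉ S → x e = 0) : Ψ *ᵥ x = cols Ψ S *ᵥ fun i : S => x i := by
  ext r
  simp only [Matrix.mulVec, dotProduct, cols, Matrix.submatrix_apply, id]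
  refine Eq.trans ?_ (Finset.sum_coe_sort S fun e => Ψ r e * x e).symm
  exact (Finset.sum_subset (Finset.subset_univ S) fun e _ he => by rw [hx e he, mul_zero]).symm

/-- The part `p` of the noise is invisible on `S`. Off `S` the identity for `q` expresses the drive
from the range of `cols Ψ S` through the increments of `z`, so only the drift from `p` accumulates
separately. -/
theorem full_path_eq {Ψ : Matrix (Fin l) E ℝ} {S : Finset E} {γ : E → ℝ}
    (hγ : ∀ e, e ∉ S → γ e = 0) {w p : Fin l → ℝ} {ν : S → ℝ} (hw : w = cols Ψ S *ᵥ ν + p)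
    (hp0 : (cols Ψ S)ᵀ *ᵥ p = 0) {κ Δt : ℝ} {z g : ℕ → S → ℝ}
    (hp : IsBregmanPath (cols Ψ S) ((fun i : S => γ i) + ν) κ Δt z g)
    {zf gf : ℕ → E → ℝ} (hz0 : zf 0 = 0)
    (hzs : ∀ k, zf (k + 1) = zf k + Δt • (Ψᵀ *ᵥ (Ψ *ᵥ γ + w - Ψ *ᵥ gf k)))
    (hg : ∀ k e, gf k e = κ * shrink (zf k e))
    {q : E → S → ℝ} (hq : ∀ j, (cols Ψ S)ᵀ *ᵥ (cols Ψ S *ᵥ q j) = (cols Ψ S)ᵀ *ᵥ (Ψᵀ j))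
    {K : ℕ} (hK : ∀ k, k ≤ K → ∀ j, j ∉ S → |q j ⬝ᵥ z k + k * Δt * (Ψᵀ j ⬝ᵥ p)| ≤ 1) :
    ∀ k, k ≤ K → (∀ i : S, gf k i = g k i) ∧ ∀ j, j ∉ S → gf k j = 0 := by
  set A := cols Ψ S with hA
  have hmain : ∀ k, k ≤ K → (∀ i : S, zf k i = z k i) ∧
      ∀ j, j ∉ S → zf k j = q j ⬝ᵥ z k + k * Δt * (Ψᵀ j ⬝ᵥ p) := by
    intro k
    induction k with
    | zero => intro _; simp [hz0, hp.z_zero]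
    | succ k ih =>
      intro hk
      obtain ⟨ih1, ih2⟩ := ih (by omega)
      have h1 : ∀ e, e ∉ S → gf k e = 0 := fun e he => by
        rw [hg, ih2 e he, shrink_eq_zero (hK k (by omega) e he), mul_zero]
      have h2 : (fun i : S => gf k i) = g k := by
        ext i
        rw [hg, hp.g_eq, ih1]
      have h3 : Ψ *ᵥ γ + w - Ψ *ᵥ gf k = A *ᵥ ((fun i : S => γ i) + ν - g k) + p := by
        rw [mulVec_eq_cols_mulVec Ψ S γ hγ, mulVec_eq_cols_mulVec Ψ S (gf k) h1, h2, hw,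
          Matrix.mulVec_sub, Matrix.mulVec_add]
        abel
      have h4 : ∀ e, zf (k + 1) e = zf k e + Δt * (Ψᵀ e ⬝ᵥ (A *ᵥ ((fun i : S => γ i) + ν - g k))
          + Ψᵀ e ⬝ᵥ p) := by
        intro e
        rw [hzs, h3, ← dotProduct_add]
        rfl
      refine ⟨fun i => ?_, fun j hj => ?_⟩
      · rw [h4, hp.z_succ, ih1]
        have h5 : Ψᵀ i ⬝ᵥ p = 0 := congrFun hp0 i
        rw [h5, add_zero]
        rfl
      · rw [h4, ih2 j hj, hp.z_succ, dotProduct_add, dotProduct_smul, smul_eq_mul]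
        have h5 : Ψᵀ j ⬝ᵥ (A *ᵥ ((fun i : S => γ i) + ν - g k))
            = q j ⬝ᵥ (Aᵀ *ᵥ (A *ᵥ ((fun i : S => γ i) + ν - g k))) := by
          rw [← transpose_mulVec_dotProduct, ← hq, transpose_mulVec_dotProduct,
            dotProduct_comm (q j), transpose_mulVec_dotProduct, dotProduct_comm]
        rw [h5]
        push_cast
        ring
  intro k hk
  obtain ⟨h1, h2⟩ := hmain k hk
  exact ⟨fun i => by rw [hg, hp.g_eq, h1],
    fun j hj => by rw [hg, h2 j hj, shrink_eq_zero (hK k hk j hj), mul_zero]⟩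

end Full

end LBI

namespace LBI

/-! ### The projection onto the cycle space -/

section Projection

variable {V E : Type*} [Fintype E] {l : ℕ}
  {X : Matrix E V ℝ} {Ψ : Matrix (Fin l) E ℝ}

theorem IsKerBasis.mul_eq_zero (h : IsKerBasis X Ψ) : Ψ * X = 0 := by
  ext r i
  have h1 : Ψ r ∈ LinearMap.ker (Xᵀ.mulVecLin) := h.2 ▸ Submodule.subset_span ⟨r, rfl⟩
  have h2 : Xᵀ *ᵥ Ψ r = 0 := h1
  have h3 := congrFun h2 i
  rw [Matrix.mulVec_transpose] at h3
  exact h3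

theorem IsKerBasis.transpose_mul_mulVec (h : IsKerBasis X Ψ) {u : E → ℝ} (hu : Xᵀ *ᵥ u = 0) :
    (Ψᵀ * Ψ) *ᵥ u = u := by
  have h1 : u ∈ Submodule.span ℝ (Set.range fun r => Ψ r) := by
    rw [h.2]
    exact hu
  obtain ⟨c, hc⟩ := (Submodule.mem_span_range_iff_exists_fun ℝ).1 h1
  have h2 : u = Ψᵀ *ᵥ c := by
    rw [← hc, Matrix.mulVec_transpose]
    ext e
    simp [Matrix.vecMul, dotProduct]
  rw [h2, Matrix.mulVec_mulVec, Matrix.mul_assoc, h.1, Matrix.mul_one]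

/-- With `R` the left side, the columns of `R` lie in `ker Xᵀ`, so `Ψᵀ Ψ R = R`; and `Ψ X = 0` gives
`Ψ R = Ψ`. Only the first Penrose equation enters. -/
theorem IsKerBasis.one_sub_eq [Fintype V] [DecidableEq E] (h : IsKerBasis X Ψ) :
    1 - X * pinv (Xᵀ * X) * Xᵀ = Ψᵀ * Ψ := by
  classical
  have hpen := isMoorePenrose_pinv_gram X
  set B := pinv (Xᵀ * X)
  have h1 : (Xᵀ * X * B - 1) * (Xᵀ * X) = 0 := by
    rw [sub_mul, one_mul, hpen.mul_mul_left, sub_self]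
  have h2 : (Xᵀ * X * B - 1) * Xᵀ = 0 := by
    have := Matrix.mul_conjTranspose_mul_self_eq_zero X (Xᵀ * X * B - 1)
    rw [Matrix.conjTranspose_eq_transpose_of_trivial] at this
    exact this.1 h1
  set R := 1 - X * B * Xᵀ with hR
  have h3 : Xᵀ * R = 0 := by
    rw [Matrix.sub_mul, Matrix.one_mul, sub_eq_zero] at h2
    rw [hR, Matrix.mul_sub, Matrix.mul_one, sub_eq_zero, ← Matrix.mul_assoc, ← Matrix.mul_assoc, h2]
  have h4 : Ψᵀ * Ψ * R = R := by
    refine Matrix.ext_of_mulVec_single fun e => ?_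
    rw [← Matrix.mulVec_mulVec]
    refine h.transpose_mul_mulVec ?_
    rw [Matrix.mulVec_mulVec, h3, Matrix.zero_mulVec]
  have h5 : Ψ * R = Ψ := by
    rw [hR, Matrix.mul_sub, Matrix.mul_one, ← Matrix.mul_assoc, ← Matrix.mul_assoc, h.mul_eq_zero]
    simp
  rw [← h4, Matrix.mul_assoc, h5]

end Projection

/-! ### Spectral quantities -/

section Spectral

variable {ι : Type*} [Fintype ι] [DecidableEq ι]

theorem lamMin_mul_le {H : Matrix ι ι ℝ} (hH : H.IsHermitian) (v : ι → ℝ) :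
    lamMin H * (v ⬝ᵥ v) ≤ v ⬝ᵥ (H *ᵥ v) := by
  have h1 : (H - algebraMap ℝ _ (lamMin H)).PosSemidef := by
    rw [Matrix.posSemidef_iff_isHermitian_and_spectrum_nonneg]
    refine ⟨hH.sub ?_, ?_⟩
    · rw [Matrix.IsHermitian, Matrix.conjTranspose_eq_transpose_of_trivial,
        Matrix.algebraMap_eq_diagonal, Matrix.diagonal_transpose]
    · rw [← spectrum.sub_singleton_eq]
      rintro x ⟨y, hy, z, hz, rfl⟩
      rw [Set.mem_singleton_iff.1 hz]
      exact sub_nonneg.2 (csInf_le (Matrix.finite_spectrum H).bddBelow hy)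
  have h2 := h1.dotProduct_mulVec_nonneg v
  rw [star_trivial, Matrix.sub_mulVec, dotProduct_sub, Algebra.algebraMap_eq_smul_one,
    Matrix.smul_mulVec, Matrix.one_mulVec, dotProduct_smul, smul_eq_mul] at h2
  linarith

theorem lamMin_zero : lamMin (0 : Matrix ι ι ℝ) = 0 := by
  unfold lamMin
  rcases isEmpty_or_nonempty ι with h | h
  · rw [spectrum.of_subsingleton, Real.sInf_empty]
  · rw [spectrum.zero_eq, csInf_singleton]

theorem specNorm_nonneg (H : Matrix ι ι ℝ) : 0 ≤ specNorm H := norm_nonneg _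

theorem dotProduct_mulVec_le_specNorm (H : Matrix ι ι ℝ) (u : ι → ℝ) :
    u ⬝ᵥ (H *ᵥ u) ≤ specNorm H * (u ⬝ᵥ u) := by
  have h1 := Matrix.inner_toEuclideanCLM H (WithLp.toLp 2 u) (WithLp.toLp 2 u)
  have h2 : ‖(WithLp.toLp 2 u : EuclideanSpace ℝ ι)‖ ^ 2 = u ⬝ᵥ u := by
    rw [EuclideanSpace.real_norm_sq_eq]
    simp [dotProduct, sq]
  change _ = u ⬝ᵥ (H *ᵥ u) at h1
  rw [← h1, ← h2]
  refine (real_inner_le_norm _ _).trans ?_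
  have h3 := (Matrix.toEuclideanCLM (n := ι) (𝕜 := ℝ) H).le_opNorm (WithLp.toLp 2 u)
  calc _ ≤ ‖(WithLp.toLp 2 u : EuclideanSpace ℝ ι)‖
        * (specNorm H * ‖(WithLp.toLp 2 u : EuclideanSpace ℝ ι)‖) := by
        gcongr
        exact h3
    _ = _ := by ring

end Spectral

/-! ### Column submatrices of `Ψ` and the constants of the two conditions. -/

section Columns

variable {E : Type*} {l : ℕ} {Ψ : Matrix (Fin l) E ℝ} {S : Finset E}

theorem cols_transpose_mulVec_le (u : Fin l → ℝ) :
    ((cols Ψ S)ᵀ *ᵥ u) ⬝ᵥ ((cols Ψ S)ᵀ *ᵥ u)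
      ≤ specNorm (cols Ψ S * (cols Ψ S)ᵀ) * (u ⬝ᵥ u) := by
  have h := dotProduct_mulVec_le_specNorm (cols Ψ S * (cols Ψ S)ᵀ) u
  rwa [← Matrix.mulVec_mulVec, ← transpose_mulVec_dotProduct] at h

variable [DecidableEq E]

theorem cMin_mul_le (hl : 0 < l) (v : S → ℝ) :
    l * cMin Ψ S * (v ⬝ᵥ v) ≤ (cols Ψ S *ᵥ v) ⬝ᵥ (cols Ψ S *ᵥ v) := by
  have hl' : (0 : ℝ) < l := by exact_mod_cast hl
  have hH : ((1 / (l : ℝ)) • ((cols Ψ S)ᵀ * cols Ψ S)).IsHermitian := by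
    rw [Matrix.IsHermitian, Matrix.conjTranspose_eq_transpose_of_trivial, Matrix.transpose_smul,
      Matrix.transpose_mul, Matrix.transpose_transpose]
  have h1 := mul_le_mul_of_nonneg_left (lamMin_mul_le hH v) hl'.le
  rw [Matrix.smul_mulVec, dotProduct_smul, smul_eq_mul, ← mul_assoc (l : ℝ) (1 / _),
    mul_one_div_cancel hl'.ne', one_mul, ← Matrix.mulVec_mulVec,
    dotProduct_comm v ((cols Ψ S)ᵀ *ᵥ _), transpose_mulVec_dotProduct] at h1
  rw [mul_assoc]
  exact h1

/-- For `l = 0` the convention `1 / 0 = 0` makes the scaled Gram matrix zero. -/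
theorem card_rows_pos (h : 0 < cMin Ψ S) : 0 < l := by
  rcases Nat.eq_zero_or_pos l with hl | hl
  · subst hl
    rw [cMin, Nat.cast_zero, div_zero, zero_smul, lamMin_zero] at h
    exact absurd h (lt_irrefl _)
  · exact hl

theorem nonempty_of_cMin_pos (h : 0 < cMin Ψ S) : S.Nonempty := by
  rw [Finset.nonempty_iff_ne_empty]
  rintro rfl
  have : cMin Ψ ∅ = 0 := by
    rw [cMin, lamMin, spectrum.of_subsingleton, Real.sInf_empty]
  exact absurd h (by rw [this]; exact lt_irrefl _)

variable [Fintype E]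

theorem sum_abs_row_le_irrep (j : E) (hj : j ∉ S) :
    ∑ i, |((cols Ψ Sᶜ)ᵀ * cols Ψ S * ((cols Ψ S)ᵀ * cols Ψ S)⁻¹)
      ⟨j, Finset.mem_compl.2 hj⟩ i| ≤ irrep Ψ S :=
  le_ciSup (f := fun j => ∑ i, |((cols Ψ Sᶜ)ᵀ * cols Ψ S * ((cols Ψ S)ᵀ * cols Ψ S)⁻¹) j i|)
    (Set.finite_range _).bddAbove (⟨j, Finset.mem_compl.2 hj⟩ : (Sᶜ : Finset E))

theorem col_dotProduct_le_muPsi (hl : 0 < l) (j : E) (hj : j ∉ S) :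
    Ψᵀ j ⬝ᵥ Ψᵀ j ≤ l * muPsi Ψ S := by
  have hl' : (0 : ℝ) < l := by exact_mod_cast hl
  have h := le_ciSup (f := fun j : (Sᶜ : Finset E) => 1 / (l : ℝ) * ∑ r, Ψ r j ^ 2)
    (Set.finite_range _).bddAbove (⟨j, Finset.mem_compl.2 hj⟩ : (Sᶜ : Finset E))
  have h2 := mul_le_mul_of_nonneg_left h hl'.le
  simp only at h2
  rw [← mul_assoc, mul_one_div_cancel hl'.ne', one_mul] at h2
  refine le_trans (le_of_eq ?_) h2
  simp [dotProduct, sq]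

theorem muPsi_nonneg : 0 ≤ muPsi Ψ S :=
  Real.iSup_nonneg fun j => by positivity

end Columns

/-! ### Least squares on an injective matrix -/

section LeastSquares

variable {ρ ι : Type*} [Fintype ρ] [Fintype ι] [DecidableEq ι] {A : Matrix ρ ι ℝ} {c : ℝ}

theorem gram_mulVec_inv (hc0 : 0 < c) (hc : ∀ v, c * (v ⬝ᵥ v) ≤ (A *ᵥ v) ⬝ᵥ (A *ᵥ v)) :
    (Aᵀ * A) * (Aᵀ * A)⁻¹ = 1 := by
  refine Matrix.mul_nonsing_inv _ ((Matrix.isUnit_iff_isUnit_det _).1 ?_)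
  refine Matrix.mulVec_injective_iff_isUnit.1 ?_
  intro u v huv
  have h1 : (Aᵀ * A) *ᵥ (u - v) = 0 := by
    rw [Matrix.mulVec_sub]
    exact sub_eq_zero.2 huv
  have h2 : (A *ᵥ (u - v)) ⬝ᵥ (A *ᵥ (u - v)) = 0 := by
    rw [← transpose_mulVec_dotProduct, Matrix.mulVec_mulVec, h1, zero_dotProduct]
  have h3 := hc (u - v)
  rw [h2] at h3
  have h4 := dotProduct_self_nonneg' (u - v)
  have h5 : (u - v) ⬝ᵥ (u - v) = 0 := le_antisymm (nonpos_of_mul_nonpos_right h3 hc0) h4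
  exact sub_eq_zero.1 (dotProduct_self_eq_zero.1 h5)

theorem gram_inv_transpose : ((Aᵀ * A)⁻¹)ᵀ = (Aᵀ * A)⁻¹ := by
  rw [Matrix.transpose_nonsing_inv, Matrix.transpose_mul, Matrix.transpose_transpose]

/-- For `x` the `i`-th column of the inverse Gram matrix, `‖A x‖² = x i`, so `c (x i)² ≤ x i`. This
bounds the variance of a coordinate of the least squares estimator. -/
theorem gram_inv_col_le (hc0 : 0 < c) (hc : ∀ v, c * (v ⬝ᵥ v) ≤ (A *ᵥ v) ⬝ᵥ (A *ᵥ v)) (i : ι) :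
    (A *ᵥ ((Aᵀ * A)⁻¹ *ᵥ Pi.single i 1)) ⬝ᵥ (A *ᵥ ((Aᵀ * A)⁻¹ *ᵥ Pi.single i 1)) ≤ 1 / c := by
  set x := (Aᵀ * A)⁻¹ *ᵥ Pi.single i 1 with hx
  have h1 : (A *ᵥ x) ⬝ᵥ (A *ᵥ x) = x i := by
    rw [← transpose_mulVec_dotProduct, Matrix.mulVec_mulVec, hx, Matrix.mulVec_mulVec,
      gram_mulVec_inv hc0 hc, Matrix.one_mulVec, single_dotProduct, one_mul]
  have h2 := hc x
  have h3 := sq_le_dotProduct_self x i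
  rw [h1] at h2 ⊢
  rw [le_div_iff₀ hc0]
  by_contra! hcon
  have h4 : c * x i ^ 2 ≤ x i := (mul_le_mul_of_nonneg_left h3 hc0.le).trans h2
  have h5 : 0 < x i := pos_of_mul_pos_left (by linarith : 0 < x i * c) hc0.le
  nlinarith

-- Take `U = A K⁻¹` with `K` the square root of the Gram matrix. Its columns turn the norm of the
-- projected noise into a sum of squares of independent Gaussians.
open scoped MatrixOrder Matrix.Norms.L2Operator in
theorem exists_orthonormal_range (hc0 : 0 < c)
    (hc : ∀ v, c * (v ⬝ᵥ v) ≤ (A *ᵥ v) ⬝ᵥ (A *ᵥ v)) :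
    ∃ U : Matrix ρ ι ℝ, Uᵀ * U = 1 ∧ U * Uᵀ = A * (Aᵀ * A)⁻¹ * Aᵀ := by
  have hps : (Aᵀ * A).PosSemidef := by
    have := Matrix.posSemidef_conjTranspose_mul_self A
    rwa [Matrix.conjTranspose_eq_transpose_of_trivial] at this
  set G := Aᵀ * A with hG
  set K := CFC.sqrt G with hK
  have hKK : K * K = G := CFC.sqrt_mul_sqrt_self G hps.nonneg
  have hKt : Kᵀ = K := by
    have h1 : IsSelfAdjoint K := (CFC.sqrt_nonneg G).isSelfAdjoint
    have h2 : Kᴴ = K := h1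
    rwa [Matrix.conjTranspose_eq_transpose_of_trivial] at h2
  have hGi : G * G⁻¹ = 1 := gram_mulVec_inv hc0 hc
  have hKi : K * K⁻¹ = 1 := by
    refine Matrix.mul_nonsing_inv _ ?_
    have h1 : IsUnit G.det := Matrix.isUnit_det_of_right_inverse hGi
    rw [← hKK, Matrix.det_mul] at h1
    exact isUnit_of_mul_isUnit_left h1
  have hKi' : K⁻¹ * K = 1 := mul_eq_one_comm.1 hKi
  have hKit : (K⁻¹)ᵀ = K⁻¹ := by rw [Matrix.transpose_nonsing_inv, hKt]
  refine ⟨A * K⁻¹, ?_, ?_⟩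
  · calc (A * K⁻¹)ᵀ * (A * K⁻¹) = K⁻¹ * (Aᵀ * A) * K⁻¹ := by
          rw [Matrix.transpose_mul, hKit]
          simp only [Matrix.mul_assoc]
      _ = (K⁻¹ * K) * (K * K⁻¹) := by
          rw [← hG, ← hKK]
          simp only [Matrix.mul_assoc]
      _ = 1 := by rw [hKi, hKi', Matrix.mul_one]
  · have h1 : G⁻¹ = K⁻¹ * K⁻¹ := by rw [← hKK, Matrix.mul_inv_rev]
    rw [Matrix.transpose_mul, hKit, h1]
    simp only [Matrix.mul_assoc]

theorem card_le_of_orthonormal {U : Matrix ρ ι ℝ} (hU : Uᵀ * U = 1) :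
    Fintype.card ι ≤ Fintype.card ρ := by
  have h1 : (Uᵀ * U).rank = Fintype.card ι := by rw [hU, Matrix.rank_one]
  rw [← h1]
  exact (Matrix.rank_mul_le_right _ _).trans (Matrix.rank_le_card_height U)

end LeastSquares
end LBI

namespace LBI

/-! ### The least squares solution -/

section LeastSquares

variable {ρ ι : Type*} [Fintype ρ] [Fintype ι] [DecidableEq ι] {A : Matrix ρ ι ℝ} {c : ℝ}

/-- The least squares solution of `A x = w`. -/
noncomputable def lsq (A : Matrix ρ ι ℝ) (w : ρ → ℝ) : ι → ℝ := (Aᵀ * A)⁻¹ *ᵥ (Aᵀ *ᵥ w)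

theorem lsq_apply (w : ρ → ℝ) (i : ι) :
    lsq A w i = (A *ᵥ ((Aᵀ * A)⁻¹ *ᵥ Pi.single i 1)) ⬝ᵥ w := by
  have h1 : (A *ᵥ ((Aᵀ * A)⁻¹ *ᵥ Pi.single i 1)) ⬝ᵥ w
      = ((Aᵀ * A)⁻¹ᵀ *ᵥ (Aᵀ *ᵥ w)) ⬝ᵥ Pi.single i 1 := by
    rw [transpose_mulVec_dotProduct, transpose_mulVec_dotProduct, dotProduct_comm]
  rw [h1, gram_inv_transpose, dotProduct_single, mul_one, lsq]

theorem dotProduct_mulVec_lsq_comm (y w : ρ → ℝ) :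
    y ⬝ᵥ (A *ᵥ lsq A w) = (A *ᵥ lsq A y) ⬝ᵥ w := by
  have h1 : y ⬝ᵥ (A *ᵥ lsq A w) = (Aᵀ *ᵥ w) ⬝ᵥ ((Aᵀ * A)⁻¹ *ᵥ (Aᵀ *ᵥ y)) := by
    rw [← transpose_mulVec_dotProduct, dotProduct_comm, lsq]
    nth_rewrite 1 [← gram_inv_transpose]
    rw [transpose_mulVec_dotProduct]
  rw [h1, transpose_mulVec_dotProduct, dotProduct_comm, lsq]

/-- Self-adjointness of the residual map: it moves the projection from the noise to the fixed
column, giving a form with deterministic coefficients. -/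
theorem dotProduct_sub_mulVec_lsq (y w : ρ → ℝ) :
    y ⬝ᵥ (w - A *ᵥ lsq A w) = (y - A *ᵥ lsq A y) ⬝ᵥ w := by
  rw [dotProduct_sub, sub_dotProduct, dotProduct_mulVec_lsq_comm]

theorem gram_mulVec_lsq (hc0 : 0 < c) (hc : ∀ v, c * (v ⬝ᵥ v) ≤ (A *ᵥ v) ⬝ᵥ (A *ᵥ v))
    (w : ρ → ℝ) : Aᵀ *ᵥ (A *ᵥ lsq A w) = Aᵀ *ᵥ w := by
  rw [lsq, Matrix.mulVec_mulVec, Matrix.mulVec_mulVec, gram_mulVec_inv hc0 hc, Matrix.one_mulVec]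

theorem dotProduct_self_eq_add_lsq (hc0 : 0 < c)
    (hc : ∀ v, c * (v ⬝ᵥ v) ≤ (A *ᵥ v) ⬝ᵥ (A *ᵥ v)) (y : ρ → ℝ) :
    y ⬝ᵥ y = (y - A *ᵥ lsq A y) ⬝ᵥ (y - A *ᵥ lsq A y)
      + (A *ᵥ lsq A y) ⬝ᵥ (A *ᵥ lsq A y) := by
  have h1 : (y - A *ᵥ lsq A y) ⬝ᵥ (A *ᵥ lsq A y) = 0 := by
    rw [← transpose_mulVec_dotProduct, Matrix.mulVec_sub, gram_mulVec_lsq hc0 hc, sub_self,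
      zero_dotProduct]
  rw [sub_dotProduct] at h1
  rw [sub_dotProduct, dotProduct_sub, dotProduct_sub, dotProduct_comm (A *ᵥ lsq A y) y]
  linarith

theorem mulVec_lsq_dotProduct_self {U : Matrix ρ ι ℝ} (hU : Uᵀ * U = 1)
    (hUA : U * Uᵀ = A * (Aᵀ * A)⁻¹ * Aᵀ) (w : ρ → ℝ) :
    (A *ᵥ lsq A w) ⬝ᵥ (A *ᵥ lsq A w) = ∑ i, (Uᵀ i ⬝ᵥ w) ^ 2 := by
  have h1 : A *ᵥ lsq A w = U *ᵥ (Uᵀ *ᵥ w) := by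
    rw [lsq, Matrix.mulVec_mulVec, Matrix.mulVec_mulVec, Matrix.mulVec_mulVec, hUA,
      Matrix.mul_assoc]
  rw [h1, ← transpose_mulVec_dotProduct, Matrix.mulVec_mulVec, hU, Matrix.one_mulVec]
  simp only [dotProduct, ← sq]
  rfl

end LeastSquares

theorem norm2_eq {ι : Type*} [Fintype ι] (v : ι → ℝ) : norm2 v = √(v ⬝ᵥ v) := by
  simp [norm2, dotProduct, sq]

theorem sqrt_dotProduct_add_le {ι : Type*} [Fintype ι] (u v : ι → ℝ) :
    √((u + v) ⬝ᵥ (u + v)) ≤ √(u ⬝ᵥ u) + √(v ⬝ᵥ v) := by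
  refine Real.sqrt_le_iff.2 ⟨by positivity, ?_⟩
  have h1 := (le_abs_self _).trans (abs_dotProduct_le_sqrt u v)
  rw [add_sq, Real.sq_sqrt (dotProduct_self_nonneg' u), Real.sq_sqrt (dotProduct_self_nonneg' v),
    add_dotProduct, dotProduct_add, dotProduct_add, dotProduct_comm v u]
  linarith

/-! ### The deterministic part of the analysis -/

section Deterministic

variable {E : Type*} [Fintype E]

theorem mem_supp {γ : E → ℝ} {e : E} : e ∈ supp γ ↔ γ e ≠ 0 := by simp [supp]

theorem eq_zero_of_notMem_supp {γ : E → ℝ} {e : E} (he : e ∉ supp γ) : γ e = 0 := by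
  by_contra h
  exact he (mem_supp.2 h)

theorem abs_le_gammaMax {γ : E → ℝ} (i : supp γ) : |γ i| ≤ gammaMax γ :=
  le_ciSup (f := fun i : supp γ => |γ i|) (Set.finite_range _).bddAbove i

theorem gammaMax_nonneg {γ : E → ℝ} : 0 ≤ gammaMax γ := Real.iSup_nonneg fun _ => abs_nonneg _

theorem gammaMin_le_abs {γ : E → ℝ} (i : supp γ) : gammaMin γ ≤ |γ i| :=
  ciInf_le (f := fun i : supp γ => |γ i|) (Set.finite_range _).bddBelow i

theorem gammaMin_pos {γ : E → ℝ} (h : (supp γ).Nonempty) : 0 < gammaMin γ := by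
  have : Nonempty (supp γ) := h.to_subtype
  obtain ⟨i, hi⟩ := exists_eq_ciInf_of_finite (f := fun i : supp γ => |γ i|)
  rw [gammaMin, ← hi]
  exact abs_pos.2 (mem_supp.1 i.2)

variable [DecidableEq E] {l : ℕ}

/-- The linear forms of the noise that control the least squares estimator on `S` and the
residual off `S`. -/
noncomputable def noiseRow (Ψ : Matrix (Fin l) E ℝ) (S : Finset E) (e : E) : Fin l → ℝ :=
  if h : e ∈ S then cols Ψ S *ᵥ (((cols Ψ S)ᵀ * cols Ψ S)⁻¹ *ᵥ Pi.single ⟨e, h⟩ 1)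
  else Ψᵀ e - cols Ψ S *ᵥ lsq (cols Ψ S) (Ψᵀ e)

/-- The bounds on the projected noise `w = Ψ ε` used in the analysis. -/
structure NoiseBound (Ψ : Matrix (Fin l) E ℝ) (S : Finset E) (σ : ℝ) (w : Fin l → ℝ) : Prop where
  row : ∀ e, |noiseRow Ψ S e ⬝ᵥ w|
    ≤ 2 * (σ * √(noiseRow Ψ S e ⬝ᵥ noiseRow Ψ S e)) * √(Real.log (Fintype.card E))
  range : √((cols Ψ S *ᵥ lsq (cols Ψ S) w) ⬝ᵥ (cols Ψ S *ᵥ lsq (cols Ψ S) w))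
    ≤ 2 * σ * (√(Real.log (Fintype.card E)) + S.card * √(Real.log l))

variable {Ψ : Matrix (Fin l) E ℝ} {S : Finset E} {σ : ℝ} {w : Fin l → ℝ}

theorem NoiseBound.abs_lsq_le (hw : NoiseBound Ψ S σ w) (hσ : 0 < σ) (hC : 0 < cMin Ψ S)
    (i : S) :
    √(l * cMin Ψ S) * |lsq (cols Ψ S) w i| ≤ 2 * σ * √(Real.log (Fintype.card E)) := by
  have hl := card_rows_pos hC
  have hc0 : 0 < l * cMin Ψ S := mul_pos (by exact_mod_cast hl) hC
  have hsc := Real.sqrt_pos.2 hc0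
  have h1 := hw.row i
  rw [noiseRow, dif_pos i.2] at h1
  rw [lsq_apply]
  have h2 := Real.sqrt_le_sqrt (gram_inv_col_le hc0 (cMin_mul_le hl) i)
  rw [Real.sqrt_div zero_le_one, Real.sqrt_one] at h2
  rw [← le_div_iff₀' hsc]
  refine h1.trans ?_
  calc _ ≤ 2 * (σ * (1 / √(l * cMin Ψ S))) * √(Real.log (Fintype.card E)) := by gcongr
    _ = _ := by field_simp

theorem NoiseBound.abs_residual_le (hw : NoiseBound Ψ S σ w) (hσ : 0 < σ) (hC : 0 < cMin Ψ S)
    {j : E} (hj : j ∉ S) :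
    |Ψᵀ j ⬝ᵥ (w - cols Ψ S *ᵥ lsq (cols Ψ S) w)|
      ≤ √(l * muPsi Ψ S) * (2 * σ * √(Real.log (Fintype.card E))) := by
  have hl := card_rows_pos hC
  have hc0 : 0 < l * cMin Ψ S := mul_pos (by exact_mod_cast hl) hC
  have h1 := hw.row j
  rw [noiseRow, dif_neg hj, ← dotProduct_sub_mulVec_lsq] at h1
  refine h1.trans ?_
  have h2 := dotProduct_self_eq_add_lsq hc0 (cMin_mul_le hl) (Ψᵀ j)
  have h3 := dotProduct_self_nonneg' (cols Ψ S *ᵥ lsq (cols Ψ S) (Ψᵀ j))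
  have h4 := col_dotProduct_le_muPsi (Ψ := Ψ) hl j hj
  have h5 := Real.sqrt_le_sqrt ((by linarith :
    (Ψᵀ j - cols Ψ S *ᵥ lsq (cols Ψ S) (Ψᵀ j)) ⬝ᵥ (Ψᵀ j - cols Ψ S *ᵥ lsq (cols Ψ S) (Ψᵀ j))
      ≤ l * muPsi Ψ S))
  calc _ ≤ 2 * (σ * √(l * muPsi Ψ S)) * √(Real.log (Fintype.card E)) := by gcongr
    _ = _ := by ring

theorem sqrt_lsq_residual_le (hC : 0 < cMin Ψ S) {j : E} (hj : j ∉ S) :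
    √((cols Ψ S *ᵥ lsq (cols Ψ S) (Ψᵀ j)) ⬝ᵥ (cols Ψ S *ᵥ lsq (cols Ψ S) (Ψᵀ j)))
      ≤ √(l * muPsi Ψ S) := by
  have hl := card_rows_pos hC
  have hc0 : 0 < l * cMin Ψ S := mul_pos (by exact_mod_cast hl) hC
  refine Real.sqrt_le_sqrt ?_
  have h2 := dotProduct_self_eq_add_lsq hc0 (cMin_mul_le hl) (Ψᵀ j)
  have h3 := dotProduct_self_nonneg' (Ψᵀ j - cols Ψ S *ᵥ lsq (cols Ψ S) (Ψᵀ j))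
  have h4 := col_dotProduct_le_muPsi (Ψ := Ψ) hl j hj
  linarith

theorem sum_abs_lsq_le (j : E) (hj : j ∉ S) :
    ∑ i, |lsq (cols Ψ S) (Ψᵀ j) i| ≤ irrep Ψ S := by
  refine le_trans (le_of_eq ?_) (sum_abs_row_le_irrep (Ψ := Ψ) j hj)
  refine Finset.sum_congr rfl fun i _ => ?_
  congr 1
  rw [lsq]
  nth_rewrite 1 [← gram_inv_transpose]
  rw [Matrix.mulVec_transpose, Matrix.mulVec_transpose]
  rfl

variable {γ : E → ℝ} {η κ Δt : ℝ}

theorem sqrt_mul_boundB (hC : 0 < cMin Ψ (supp γ)) :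
    √(l * cMin Ψ (supp γ)) * boundB Ψ γ σ
      = √(l * cMin Ψ (supp γ)) * gammaMax γ + (norm2 (Ψ *ᵥ γ)
        + 2 * σ * (√(Real.log (Fintype.card E)) + (supp γ).card * √(Real.log l))) := by
  have hl := card_rows_pos hC
  have hc0 : 0 < l * cMin Ψ (supp γ) := mul_pos (by exact_mod_cast hl) hC
  have hsc := Real.sqrt_pos.2 hc0
  rw [boundB, mul_comm (cMin Ψ (supp γ)), Real.sqrt_div' _ hc0.le]
  field_simp
  ring

theorem boundB_nonneg (hσ : 0 < σ) : 0 ≤ boundB Ψ γ σ := by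
  have := gammaMax_nonneg (γ := γ)
  unfold boundB norm2
  positivity

theorem tauBar_mul_le (hσ : 0 < σ) (hκ : 0 < κ) (hη0 : 0 < η) (hl : 0 < l)
    (hm : 0 < Real.log (Fintype.card E)) (hB : boundB Ψ γ σ ≤ κ * η) :
    tauBar Ψ γ σ η κ * (√(l * muPsi Ψ (supp γ)) * (2 * σ * √(Real.log (Fintype.card E))))
      ≤ η - boundB Ψ γ σ / κ := by
  have hl' : (0 : ℝ) < l := by exact_mod_cast hl
  have he : 0 ≤ η - boundB Ψ γ σ / κ := sub_nonneg.2 ((div_le_iff₀' hκ).2 hB)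
  -- If `muPsi` vanishes, for instance when every comparison is an outlier, the division by zero
  -- makes `tauBar` equal to `0`.
  rcases (muPsi_nonneg (Ψ := Ψ) (S := supp γ)).eq_or_lt with h | h
  · rw [← h]
    simpa using he
  · refine le_of_eq ?_
    have h1 := Real.sqrt_pos.2 h
    have h2 := Real.sqrt_pos.2 hl'
    have h3 := Real.sqrt_pos.2 hm
    rw [tauBar, Real.sqrt_div zero_le_one, Real.sqrt_one, Real.sqrt_mul hl'.le,
      Real.sqrt_mul hl'.le]
    field_simp

theorem tauBar_nonneg (hσ : 0 < σ) (hκ : 0 < κ) (hη0 : 0 < η)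
    (hB : boundB Ψ γ σ ≤ κ * η) : 0 ≤ tauBar Ψ γ σ η κ := by
  have h1 : 0 ≤ 1 - boundB Ψ γ σ / (κ * η) := sub_nonneg.2 ((div_le_one (by positivity)).2 hB)
  unfold tauBar
  positivity

variable {V : Type*} [Fintype V] {X : Matrix E V ℝ}

theorem lbi_succ_fst (hΨ : IsKerBasis X Ψ) (θ : V → ℝ) (γ ε : E → ℝ) (k : ℕ) :
    (lbi X κ Δt (fun e => (X *ᵥ θ) e + γ e + ε e) (k + 1)).1
      = (lbi X κ Δt (fun e => (X *ᵥ θ) e + γ e + ε e) k).1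
        + Δt • (Ψᵀ *ᵥ (Ψ *ᵥ γ + Ψ *ᵥ ε
          - Ψ *ᵥ (lbi X κ Δt (fun e => (X *ᵥ θ) e + γ e + ε e) k).2)) := by
  have hY : (fun e => (X *ᵥ θ) e + γ e + ε e) = X *ᵥ θ + γ + ε := rfl
  rw [lbi, hΨ.one_sub_eq, hY, ← Matrix.mulVec_mulVec, Matrix.mulVec_sub, Matrix.mulVec_add,
    Matrix.mulVec_add, Matrix.mulVec_mulVec θ, hΨ.mul_eq_zero, Matrix.zero_mulVec, zero_add]

/-- Up to time `tauBar` the iterates are supported on `supp γ` and follow the iteration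
restricted to `supp γ`, driven by the least squares estimator. -/
theorem exists_restricted_path (hΨ : IsKerBasis X Ψ) (θ : V → ℝ) (ε : E → ℝ) (hσ : 0 < σ)
    (hC : 0 < cMin Ψ (supp γ)) (hη0 : 0 < η) (hC2 : irrep Ψ (supp γ) ≤ 1 - η)
    (hκ : 0 < κ) (hΔt : 0 < Δt) (hB : boundB Ψ γ σ ≤ κ * η)
    (hstep : κ * Δt * specNorm (cols Ψ (supp γ) * (cols Ψ (supp γ))ᵀ) < 2)
    (hm : 0 < Real.log (Fintype.card E)) (hw : NoiseBound Ψ (supp γ) σ (Ψ *ᵥ ε)) :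
    ∃ z g, IsBregmanPath (cols Ψ (supp γ))
        ((fun i : supp γ => γ i) + lsq (cols Ψ (supp γ)) (Ψ *ᵥ ε)) κ Δt z g ∧
      ∀ k : ℕ, k * Δt ≤ tauBar Ψ γ σ η κ →
        (∀ i : supp γ, lbiPath X κ Δt (fun e => (X *ᵥ θ) e + γ e + ε e) k i = g k i) ∧
        ∀ j, j ∉ supp γ → lbiPath X κ Δt (fun e => (X *ᵥ θ) e + γ e + ε e) k j = 0 := by
  have hl := card_rows_pos hC
  have hc0 : 0 < l * cMin Ψ (supp γ) := mul_pos (by exact_mod_cast hl) hC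
  have hsc := Real.sqrt_pos.2 hc0
  set w := Ψ *ᵥ ε with hwdef
  set A := cols Ψ (supp γ) with hA
  set ν := lsq A w with hν
  have hc : ∀ v, l * cMin Ψ (supp γ) * (v ⬝ᵥ v) ≤ (A *ᵥ v) ⬝ᵥ (A *ᵥ v) := cMin_mul_le hl
  have hr : ∀ u, (Aᵀ *ᵥ u) ⬝ᵥ (Aᵀ *ᵥ u) ≤ specNorm (A * Aᵀ) * (u ⬝ᵥ u) := cols_transpose_mulVec_le
  obtain ⟨z, g, hp⟩ := exists_isBregmanPath A ((fun i : supp γ => γ i) + ν) κ Δt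
  refine ⟨z, g, hp, fun k hk => ?_⟩
  set Y : E → ℝ := fun e => (X *ᵥ θ) e + γ e + ε e with hY
  refine full_path_eq (p := w - A *ᵥ ν) (ν := ν) (w := w) (fun e he => eq_zero_of_notMem_supp he)
    (by simp [← hA]) ?_ hp (zf := fun k => (lbi X κ Δt Y k).1) (gf := fun k => (lbi X κ Δt Y k).2)
    rfl (fun k => lbi_succ_fst hΨ θ γ ε k) ?_ (q := fun j => lsq A (Ψᵀ j))
    (fun j => gram_mulVec_lsq hc0 hc _) (K := k) ?_ k le_rfl
  · rw [← hA, Matrix.mulVec_sub, hν, gram_mulVec_lsq hc0 hc, sub_self]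
  · intro k e
    cases k with
    | zero => simp [lbi, shrink_eq_zero]
    | succ k => rfl
  · intro k' hk' j hj
    refine hp.abs_off_support_le hκ hΔt (specNorm_nonneg _) hr hstep.le hc0 hc
      (η := η) (B := boundB Ψ γ σ) (D := 2 * σ * √(Real.log (Fintype.card E)))
      (F := norm2 (Ψ *ᵥ γ)
        + 2 * σ * (√(Real.log (Fintype.card E)) + (supp γ).card * √(Real.log l)))
      (M := √(l * muPsi Ψ (supp γ))) (gmax := gammaMax γ) (by positivity) (boundB_nonneg hσ)
      gammaMax_nonneg hB ?_ (sqrt_mul_boundB hC).ge ?_ ((sum_abs_lsq_le j hj).trans hC2)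
      (sqrt_lsq_residual_le hC hj) (hw.abs_residual_le hσ hC hj) ?_
    · rw [Matrix.mulVec_add, norm2_eq, mulVec_eq_cols_mulVec Ψ (supp γ) γ
        fun e he => eq_zero_of_notMem_supp he]
      exact (sqrt_dotProduct_add_le _ _).trans (add_le_add_right hw.range _)
    · intro i
      have h1 := hw.abs_lsq_le hσ hC i
      have h2 := abs_le_gammaMax i
      have h3 := abs_add_le (γ i) (ν i)
      have h4 : √(l * cMin Ψ (supp γ)) * |γ i + ν i|
          ≤ √(l * cMin Ψ (supp γ)) * (gammaMax γ + |ν i|) := by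
        gcongr
        linarith
      rw [mul_add] at h4
      exact h4.trans (by linarith)
    · have h1 : (k' : ℝ) * Δt ≤ tauBar Ψ γ σ η κ := by
        refine le_trans ?_ hk
        gcongr
      refine le_trans ?_ (tauBar_mul_le hσ hκ hη0 hl hm hB)
      gcongr

end Deterministic
end LBI

/-! ### Consistency of the restricted iteration and the noise event for `Ψ`. -/

namespace LBI

theorem norm2_sq_eq_sum_supp {E : Type*} [Fintype E] {γ : E → ℝ} :
    norm2 γ ^ 2 = ∑ i : supp γ, γ i ^ 2 := by
  rw [norm2, Real.sq_sqrt (by positivity)]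
  refine Eq.trans ?_ (Finset.sum_coe_sort (supp γ) fun e => γ e ^ 2).symm
  exact (Finset.sum_subset (Finset.subset_univ _) fun e _ he => by
    rw [eq_zero_of_notMem_supp he]; simp).symm

section Consistency

variable {E : Type*} [Fintype E] [DecidableEq E] {l : ℕ} {Ψ : Matrix (Fin l) E ℝ} {σ κ Δt : ℝ}
  {γ : E → ℝ} {ν : supp γ → ℝ} {z g : ℕ → supp γ → ℝ}

theorem cTilde_pos (hC : 0 < cMin Ψ (supp γ))
    (hstep : κ * Δt * specNorm (cols Ψ (supp γ) * (cols Ψ (supp γ))ᵀ) < 2) :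
    0 < cTilde Ψ (supp γ) (κ * Δt) := by
  have hl : (0 : ℝ) < l := by exact_mod_cast card_rows_pos hC
  exact mul_pos (mul_pos hC hl) (by linarith)

theorem potential_decrease
    (hp : IsBregmanPath (cols Ψ (supp γ)) ((fun i : supp γ => γ i) + ν) κ Δt z g)
    (hC : 0 < cMin Ψ (supp γ)) (hκ : 0 < κ) (hΔt : 0 < Δt)
    (hstep : κ * Δt * specNorm (cols Ψ (supp γ) * (cols Ψ (supp γ))ᵀ) < 2) (k : ℕ) :
    potential ((fun i : supp γ => γ i) + ν) κ (z (k + 1)) (g (k + 1))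
      ≤ potential ((fun i : supp γ => γ i) + ν) κ (z k) (g k)
        - cTilde Ψ (supp γ) (κ * Δt) * Δt * ((g k - ((fun i : supp γ => γ i) + ν))
          ⬝ᵥ (g k - ((fun i : supp γ => γ i) + ν))) := by
  have h := hp.potential_succ_le hκ hΔt cols_transpose_mulVec_le (cMin_mul_le (card_rows_pos hC))
    hstep.le k
  rwa [cTilde, mul_comm (cMin Ψ (supp γ))]

theorem sign_consistency
    (hp : IsBregmanPath (cols Ψ (supp γ)) ((fun i : supp γ => γ i) + ν) κ Δt z g)
    (hC : 0 < cMin Ψ (supp γ)) (hκ : 0 < κ) (hΔt : 0 < Δt)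
    (hstep : κ * Δt * specNorm (cols Ψ (supp γ) * (cols Ψ (supp γ))ᵀ) < 2)
    (hν : ∀ i, |ν i| ≤ gammaMin γ / 2) {τ : ℝ}
    (hτ : (8 + 4 * Real.log (supp γ).card) / (cTilde Ψ (supp γ) (κ * Δt) * gammaMin γ)
      + 1 / (κ * cTilde Ψ (supp γ) (κ * Δt)) * Real.log (3 * norm2 γ / gammaMin γ) + 3 * Δt ≤ τ)
    (i : supp γ) : SignType.sign (g ⌊τ / Δt⌋₊ i) = SignType.sign (γ i) := by
  have hS := nonempty_of_cMin_pos hC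
  have hγmin := gammaMin_pos hS
  have : Nonempty (supp γ) := hS.to_subtype
  -- Half of `gammaMin` is given to `ν`. This leaves `a ≤ |g₀ i| ≤ 3/2 |γ i|`, the origin of the
  -- constants `8 + 4 log s` and `3` in the time condition.
  set a := gammaMin γ / 2 with ha
  have ha0 : 0 < a := by positivity
  set lam := cTilde Ψ (supp γ) (κ * Δt) with hlam
  have hlam0 : 0 < lam := cTilde_pos hC hstep
  set g₀ : supp γ → ℝ := (fun i : supp γ => γ i) + ν with hg₀
  have habs : ∀ i : supp γ, 2 * a ≤ |γ i| := fun i => by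
    have := gammaMin_le_abs i
    linarith
  have hmin : ∀ i, a ≤ |g₀ i| := by
    intro i
    have h1 := abs_sub_abs_le_abs_add (γ i) (ν i)
    have h2 := hν i
    have h3 := habs i
    simp only [hg₀, Pi.add_apply]
    linarith
  have hsign : SignType.sign (g₀ i) = SignType.sign (γ i) := by
    refine sign_eq_of_abs_sub_lt ?_
    simp only [hg₀, Pi.add_apply, add_sub_cancel_left]
    linarith [hν i, habs i]
  have hG : g₀ ⬝ᵥ g₀ ≤ (3 / 2 * norm2 γ) ^ 2 := by
    rw [mul_pow, norm2_sq_eq_sum_supp, Finset.mul_sum]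
    refine Finset.sum_le_sum fun i _ => ?_
    have h1 : |g₀ i| ≤ 3 / 2 * |γ i| := by
      refine (abs_add_le _ _).trans ?_
      linarith [hν i, habs i]
    calc g₀ i * g₀ i = |g₀ i| * |g₀ i| := (abs_mul_abs_self _).symm
      _ ≤ (3 / 2 * |γ i|) * (3 / 2 * |γ i|) := by gcongr
      _ = (3 / 2) ^ 2 * γ i ^ 2 := by rw [← sq_abs (γ i)]; ring
  have hGpos : 0 < g₀ ⬝ᵥ g₀ := by
    have h1 := sq_le_dotProduct_self g₀ i
    have h2 := hmin i
    rw [← sq_abs] at h1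
    nlinarith
  have hnorm : 0 < norm2 γ := by
    rcases (Real.sqrt_nonneg (∑ i, γ i ^ 2)).eq_or_lt with h | h
    · have h1 : norm2 γ = 0 := h.symm
      rw [h1] at hG
      norm_num at hG
      linarith
    · exact h
  have hlog : 1 / (2 * κ) * Real.log (g₀ ⬝ᵥ g₀ / a ^ 2)
      ≤ 1 / κ * Real.log (3 * norm2 γ / gammaMin γ) := by
    have h1 : Real.log (g₀ ⬝ᵥ g₀ / a ^ 2) ≤ 2 * Real.log (3 * norm2 γ / gammaMin γ) := by
      have h2 : (2 : ℝ) * Real.log (3 * norm2 γ / gammaMin γ)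
          = Real.log ((3 * norm2 γ / gammaMin γ) ^ 2) := by rw [Real.log_pow]; norm_num
      rw [h2]
      refine Real.log_le_log (by positivity) ?_
      rw [div_le_iff₀ (by positivity)]
      refine hG.trans (le_of_eq ?_)
      rw [ha]
      field_simp
    calc _ ≤ 1 / (2 * κ) * (2 * Real.log (3 * norm2 γ / gammaMin γ)) := by gcongr
      _ = _ := by field_simp
  have hlt := hp.dist_lt_min hκ hΔt hlam0 (potential_decrease hp hC hκ hΔt hstep) ha0 hmin
    (k := ⌊τ / Δt⌋₊) ?_
  · rw [← hsign]
    exact sign_eq_of_abs_sub_lt (IsBregmanPath.abs_sub_lt_of_lt hmin ha0 hlt i)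
  -- The floor loses up to one step; with the two roundings allowed for in `dist_lt_min` this
  -- accounts for `3 * Δt`.
  · have h1 : τ < (⌊τ / Δt⌋₊ + 1) * Δt := by
      rw [← div_lt_iff₀ hΔt]
      exact Nat.lt_floor_add_one _
    have h2 := mul_le_mul_of_nonneg_left hτ hlam0.le
    have h3 : lam * ((8 + 4 * Real.log (supp γ).card) / (lam * gammaMin γ)
        + 1 / (κ * lam) * Real.log (3 * norm2 γ / gammaMin γ) + 3 * Δt)
        = (4 + 2 * Real.log (supp γ).card) / a + 1 / κ * Real.log (3 * norm2 γ / gammaMin γ)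
          + 3 * (lam * Δt) := by
      rw [ha]
      field_simp
      ring
    rw [h3] at h2
    have h4 := mul_lt_mul_of_pos_left h1 hlam0
    rw [Fintype.card_coe]
    linarith

theorem exists_l2_bound
    (hp : IsBregmanPath (cols Ψ (supp γ)) ((fun i : supp γ => γ i) + ν) κ Δt z g)
    (hC : 0 < cMin Ψ (supp γ)) (hκ : 0 < κ) (hΔt : 0 < Δt) (hσ : 0 < σ)
    (hstep : κ * Δt * specNorm (cols Ψ (supp γ) * (cols Ψ (supp γ))ᵀ) < 2) {L : ℝ} (hL : 0 < L)
    (hν : ∀ i, √(l * cMin Ψ (supp γ)) * |ν i| ≤ 2 * σ * √L) {τ : ℝ} (hτ0 : 0 ≤ τ)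
    {C : ℝ} (hC0 : 0 < C)
    (hτ : 1 / (2 * κ * cTilde Ψ (supp γ) (κ * Δt)) * (1 + Real.log
          ((l * norm2 γ ^ 2 + 4 * σ ^ 2 * (supp γ).card * L / cMin Ψ (supp γ))
            / (C ^ 2 * (supp γ).card * L)))
        + 4 / (C * cTilde Ψ (supp γ) (κ * Δt)) * √(l / L) + 2 * Δt ≤ τ) :
    ∃ k : ℕ, k * Δt ≤ τ ∧ √((g k - fun i : supp γ => γ i) ⬝ᵥ (g k - fun i : supp γ => γ i))
      ≤ (C + 2 * σ / √(cMin Ψ (supp γ))) * √((supp γ).card * L / l) := by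
  have hS := nonempty_of_cMin_pos hC
  have hl : (0 : ℝ) < l := by exact_mod_cast card_rows_pos hC
  set s : ℝ := ((supp γ).card : ℝ) with hs
  have hs0 : 0 < s := by rw [hs]; exact_mod_cast hS.card_pos
  set lam := cTilde Ψ (supp γ) (κ * Δt) with hlam
  have hlam0 : 0 < lam := cTilde_pos hC hstep
  set cm := cMin Ψ (supp γ) with hcm
  have hc0 : 0 < l * cm := mul_pos hl hC
  have hsc := Real.sqrt_pos.2 hc0
  set a := C * √(s * L / l) with ha
  have hrt : 0 < √(s * L / l) := Real.sqrt_pos.2 (by positivity)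
  have ha0 : 0 < a := by positivity
  have ha2 : a ^ 2 = C ^ 2 * (s * L / l) := by
    rw [ha, mul_pow, Real.sq_sqrt (by positivity)]
  set g₀ : supp γ → ℝ := (fun i : supp γ => γ i) + ν with hg₀
  have hνν : ν ⬝ᵥ ν ≤ s * (4 * σ ^ 2 * L / (l * cm)) := by
    have h1 : ∀ i, ν i * ν i ≤ 4 * σ ^ 2 * L / (l * cm) := by
      intro i
      rw [le_div_iff₀' hc0]
      have h2 := pow_le_pow_left₀ (by positivity) (hν i) 2
      rw [mul_pow, mul_pow, mul_pow, Real.sq_sqrt hc0.le, Real.sq_sqrt hL.le, sq_abs] at h2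
      linarith
    refine (Finset.sum_le_sum fun i _ => h1 i).trans ?_
    rw [Finset.sum_const, nsmul_eq_mul, Finset.card_univ, Fintype.card_coe]
  set y := norm2 γ ^ 2 + s * (4 * σ ^ 2 * L / (l * cm)) with hy
  have hy0 : 0 < y := by positivity
  -- The factor `2` costs `log 2 < 1`, which is the summand `1` in front of the logarithm in the
  -- time condition.
  have hGy : g₀ ⬝ᵥ g₀ ≤ 2 * y := by
    have h1 : g₀ ⬝ᵥ g₀ ≤ 2 * (∑ i : supp γ, γ i ^ 2 + ν ⬝ᵥ ν) := by
      simp only [dotProduct]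
      rw [← Finset.sum_add_distrib, Finset.mul_sum]
      refine Finset.sum_le_sum fun i _ => ?_
      simp only [hg₀, Pi.add_apply]
      nlinarith [sq_nonneg (γ i - ν i)]
    rw [← norm2_sq_eq_sum_supp] at h1
    linarith
  have hfinal : ∀ k, (g k - g₀) ⬝ᵥ (g k - g₀) ≤ a ^ 2 →
      √((g k - fun i : supp γ => γ i) ⬝ᵥ (g k - fun i : supp γ => γ i))
        ≤ (C + 2 * σ / √cm) * √(s * L / l) := by
    intro k hk
    have h1 : (g k - fun i : supp γ => γ i) = (g k - g₀) + ν := by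
      rw [hg₀]; abel
    rw [h1]
    refine (sqrt_dotProduct_add_le _ _).trans ?_
    rw [add_mul]
    refine add_le_add ((Real.sqrt_le_sqrt hk).trans (Real.sqrt_sq ha0.le).le) ?_
    refine (Real.sqrt_le_sqrt hνν).trans (le_of_eq ?_)
    have h2 : s * (4 * σ ^ 2 * L / (l * cm)) = (2 * σ / √cm) ^ 2 * (s * L / l) := by
      rw [div_pow, Real.sq_sqrt hC.le]
      field_simp
      norm_num
    rw [h2, Real.sqrt_mul (sq_nonneg _), Real.sqrt_sq (by positivity)]
  -- Otherwise the zero start is already within `a` of `g₀`, and `k = 0` serves.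
  by_cases hcase : a ^ 2 ≤ g₀ ⬝ᵥ g₀
  · have harg : (l * norm2 γ ^ 2 + 4 * σ ^ 2 * s * L / cm) / (C ^ 2 * s * L) = y / a ^ 2 := by
      rw [ha2, hy]
      field_simp
    rw [harg] at hτ
    have hlog : Real.log (g₀ ⬝ᵥ g₀ / a ^ 2) ≤ 1 + Real.log (y / a ^ 2) := by
      have h1 : Real.log (g₀ ⬝ᵥ g₀ / a ^ 2) ≤ Real.log (2 * (y / a ^ 2)) := by
        refine Real.log_le_log (div_pos (lt_of_lt_of_le (by positivity) hcase) (by positivity)) ?_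
        rw [← mul_div_assoc]
        gcongr
      rw [Real.log_mul two_ne_zero (by positivity)] at h1
      linarith [Real.log_two_lt_d9]
    obtain ⟨k, hk, hk'⟩ := hp.exists_dist_le hκ hΔt hlam0
      (potential_decrease hp hC hκ hΔt hstep) ha0 hcase (K := ⌊τ / Δt⌋₊) (by
        have h1 : τ < (⌊τ / Δt⌋₊ + 1) * Δt := by
          rw [← div_lt_iff₀ hΔt]
          exact Nat.lt_floor_add_one _
        have h2 := mul_le_mul_of_nonneg_left hτ hlam0.le
        have hsa : √s / a = 1 / C * √(l / L) := by
          rw [ha, Real.sqrt_div' _ hL.le, Real.sqrt_div' _ hl.le, Real.sqrt_mul hs0.le]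
          have := Real.sqrt_pos.2 hs0
          have := Real.sqrt_pos.2 hL
          have := Real.sqrt_pos.2 hl
          field_simp
        have h3 : lam * (1 / (2 * κ * lam) * (1 + Real.log (y / a ^ 2))
            + 4 / (C * lam) * √(l / L) + 2 * Δt)
            = 1 / (2 * κ) * (1 + Real.log (y / a ^ 2)) + 4 * (1 / C * √(l / L))
              + 2 * (lam * Δt) := by
          field_simp
        rw [h3, ← hsa, ← mul_div_assoc] at h2
        have h4 := mul_lt_mul_of_pos_left h1 hlam0
        have h5 : 1 / (2 * κ) * Real.log (g₀ ⬝ᵥ g₀ / a ^ 2)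
            ≤ 1 / (2 * κ) * (1 + Real.log (y / a ^ 2)) := by gcongr
        rw [Fintype.card_coe, ← hs]
        linarith)
    refine ⟨k, ?_, hfinal k hk'⟩
    rw [← le_div_iff₀ hΔt]
    exact (Nat.le_floor_iff (by positivity)).1 hk
  · refine ⟨0, by simpa using hτ0, hfinal 0 ?_⟩
    rw [hp.g_zero, zero_sub, neg_dotProduct_neg]
    exact (not_le.1 hcase).le

end Consistency

theorem exists_noiseBound_event {V E Ω : Type*} [Fintype E] [DecidableEq E] [MeasurableSpace Ω]
    {P : Measure Ω} [IsProbabilityMeasure P] {l n : ℕ} {X : Matrix E V ℝ}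
    {Ψ : Matrix (Fin l) E ℝ} (hΨ : IsKerBasis X Ψ) {S : Finset E} (hC : 0 < cMin Ψ S) {σ : ℝ}
    (hσ : 0 < σ) {ε : E → Ω → ℝ} (hindep : iIndepFun ε P)
    (hlaw : ∀ e, HasLaw (ε e) (gaussianReal 0 (σ ^ 2).toNNReal) P) (hn : 2 ≤ n)
    (hnm : n ≤ Fintype.card E) :
    ∃ A : Set Ω, MeasurableSet A ∧
      1 - 1 / (Fintype.card E * √(Real.log (Fintype.card E))) - 2 / (n * √(Real.log n))
        ≤ P.real A ∧
      ∀ ω ∈ A, NoiseBound Ψ S σ (Ψ *ᵥ fun e => ε e ω) := by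
  have hl := card_rows_pos hC
  have hc0 : 0 < l * cMin Ψ S := mul_pos (by exact_mod_cast hl) hC
  obtain ⟨U, hU, hUA⟩ := exists_orthonormal_range hc0 (cMin_mul_le (Ψ := Ψ) (S := S) hl)
  -- Linear forms of `Ψ ε` pull back along `Ψᵀ` to forms of `ε` with the same inner products, so
  -- variances and orthonormality are preserved.
  have hiso : ∀ u v : Fin l → ℝ, (Ψᵀ *ᵥ u) ⬝ᵥ (Ψᵀ *ᵥ v) = u ⬝ᵥ v := fun u v => by
    rw [transpose_mulVec_dotProduct, Matrix.mulVec_mulVec, hΨ.1, Matrix.one_mulVec]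
  have hcard := card_le_of_orthonormal hU
  rw [Fintype.card_fin] at hcard
  have hv : ((σ ^ 2).toNNReal : ℝ) = σ ^ 2 := Real.coe_toNNReal _ (sq_nonneg σ)
  obtain ⟨A, hA, hPA, hAb⟩ := exists_noise_event hindep
    (by simpa using hσ.ne') hlaw (fun e => Ψᵀ *ᵥ noiseRow Ψ S e) (fun i => Ψᵀ *ᵥ Uᵀ i)
    (fun i j => by
      rw [hiso, ← Matrix.one_apply, ← hU]
      rfl) hn hnm (by
      rw [Fintype.card_coe]
      exact (nonempty_of_cMin_pos hC).card_pos) hcard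
  refine ⟨A, hA, hPA, fun ω hω => ?_⟩
  obtain ⟨h1, h2⟩ := hAb ω hω
  simp only [hiso, transpose_mulVec_dotProduct, hv, Real.sqrt_mul (sq_nonneg σ), Real.sqrt_sq hσ.le, Fintype.card_coe] at h1 h2
  exact ⟨h1, by rwa [mulVec_lsq_dotProduct_self hU hUA]⟩

end LBI

/-! ### The consistency theorem. -/

theorem theorem2
    {V E Ω : Type*} [Fintype V] [DecidableEq V] [Fintype E] [DecidableEq E]
    [MeasurableSpace Ω] (P : Measure Ω) [IsProbabilityMeasure P]
    -- the connected comparison graph, and `Ψ = U₂ᵀ`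
    (G : ComparisonGraph V E) (hG : G.simpleGraph.Connected)
    (Ψ : Matrix (Fin (LBI.numRows V E)) E ℝ) (hΨ : LBI.IsKerBasis G.gradient Ψ)
    -- the true scores, the outliers and the Gaussian noise
    (θ : V → ℝ) (γ : E → ℝ) (σ : ℝ) (hσ : 0 < σ)
    (ε : E → Ω → ℝ) (hindep : iIndepFun ε P)
    (hlaw : ∀ e, HasLaw (ε e) (gaussianReal 0 (σ ^ 2).toNNReal) P)
    -- C1 and C2
    (hC1 : 0 < LBI.cMin Ψ (LBI.supp γ))
    (η : ℝ) (hη0 : 0 < η) (hη1 : η ≤ 1)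
    (hC2 : LBI.irrep Ψ (LBI.supp γ) ≤ 1 - η)
    -- the parameters of the algorithm
    (κ Δt : ℝ) (hκ : 0 < κ) (hΔt : 0 < Δt)
    (hB : LBI.boundB Ψ γ σ ≤ κ * η)
    (hstep : κ * Δt *
      LBI.specNorm (LBI.cols Ψ (LBI.supp γ) * (LBI.cols Ψ (LBI.supp γ))ᵀ) < 2) :
    let n : ℝ := Fintype.card V
    let m : ℝ := Fintype.card E
    let l : ℝ := LBI.numRows V E
    let s : ℝ := (LBI.supp γ).card
    let τ : ℝ := LBI.tauBar Ψ γ σ η κ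
    let Cmin : ℝ := LBI.cMin Ψ (LBI.supp γ)
    let Ct : ℝ := LBI.cTilde Ψ (LBI.supp γ) (κ * Δt)
    let Y : Ω → E → ℝ := fun ω e => (G.gradient *ᵥ θ) e + γ e + ε e ω
    let path : Ω → ℕ → E → ℝ := fun ω k => LBI.lbiPath G.gradient κ Δt (Y ω) k
    ∃ A : Set Ω, MeasurableSet A ∧
      1 - 1 / (m * Real.sqrt (Real.log m)) - 2 / (n * Real.sqrt (Real.log n)) ≤ P.real A ∧
      ∀ ω ∈ A,
        -- no false positives
        (∀ k : ℕ, k * Δt ≤ τ → LBI.supp (path ω k) ⊆ LBI.supp γ) ∧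
        -- sign consistency
        (4 * σ / Real.sqrt Cmin * Real.sqrt (Real.log m / l) ≤ LBI.gammaMin γ →
          (8 + 4 * Real.log s) / (Ct * LBI.gammaMin γ)
              + 1 / (κ * Ct) * Real.log (3 * LBI.norm2 γ / LBI.gammaMin γ) + 3 * Δt ≤ τ →
          ∀ e, SignType.sign (path ω ⌊τ / Δt⌋₊ e) = SignType.sign (γ e)) ∧
        -- bound on the estimation error
        (∀ C : ℝ, 0 < C →
          1 / (2 * κ * Ct) * (1 + Real.log
                ((l * LBI.norm2 γ ^ 2 + 4 * σ ^ 2 * s * Real.log m / Cmin)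
                  / (C ^ 2 * s * Real.log m)))
              + 4 / (C * Ct) * Real.sqrt (l / Real.log m) + 2 * Δt ≤ τ →
          ∃ k : ℕ, k * Δt ≤ τ ∧
            LBI.norm2 (path ω k - γ)
              ≤ (C + 2 * σ / Real.sqrt Cmin) * Real.sqrt (s * Real.log m / l)) := by
  intro n m l s τ Cmin Ct Y path
  set S := LBI.supp γ with hS
  have hl : 0 < LBI.numRows V E := LBI.card_rows_pos hC1
  -- The number of rows is a truncated difference, so its positivity carries this inequality.
  have hnm : Fintype.card V ≤ Fintype.card E := by
    unfold LBI.numRows at hl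
    omega
  have hSne : S.Nonempty := LBI.nonempty_of_cMin_pos hC1
  have hn : 2 ≤ Fintype.card V := by
    obtain ⟨e, _⟩ := hSne
    exact Fintype.one_lt_card_iff.2 ⟨G.src e, G.tgt e, G.src_ne_tgt e⟩
  have hlogm : 0 < Real.log (Fintype.card E) :=
    Real.log_pos (by exact_mod_cast hn.trans hnm)
  have hl0 : (0 : ℝ) < LBI.numRows V E := by exact_mod_cast hl
  have hc0 : (0 : ℝ) < LBI.numRows V E * LBI.cMin Ψ S := mul_pos hl0 hC1
  have hτ0 : 0 ≤ τ := LBI.tauBar_nonneg hσ hκ hη0 hB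
  obtain ⟨A, hA, hPA, hAb⟩ := LBI.exists_noiseBound_event hΨ hC1 hσ hindep hlaw hn hnm
  refine ⟨A, hA, hPA, fun ω hω => ?_⟩
  have hw := hAb ω hω
  obtain ⟨z, g, hp, hpath⟩ := LBI.exists_restricted_path hΨ θ (fun e => ε e ω) hσ hC1 hη0 hC2 hκ
    hΔt hB hstep hlogm hw
  have hνc : ∀ i, √(LBI.numRows V E * LBI.cMin Ψ S)
      * |LBI.lsq (LBI.cols Ψ S) (Ψ *ᵥ fun e => ε e ω) i| ≤ 2 * σ * √(Real.log (Fintype.card E)) :=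
    fun i => hw.abs_lsq_le hσ hC1 i
  refine ⟨fun k hk e he => ?_, fun hmin hτ e => ?_, fun C hC hτ => ?_⟩
  · by_contra hcon
    exact LBI.mem_supp.1 he ((hpath k hk).2 e hcon)
  · have hfloor : (⌊τ / Δt⌋₊ : ℝ) * Δt ≤ τ := by
      rw [← le_div_iff₀ hΔt]
      exact Nat.floor_le (by positivity)
    obtain ⟨h1, h2⟩ := hpath _ hfloor
    by_cases he : e ∈ S
    · change SignType.sign (LBI.lbiPath _ _ _ _ _ e) = _
      rw [h1 ⟨e, he⟩]
      refine LBI.sign_consistency hp hC1 hκ hΔt hstep (fun i => ?_) hτ ⟨e, he⟩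
      have h3 : 4 * σ / √Cmin * √(Real.log m / l)
          = 4 * σ * √(Real.log (Fintype.card E)) / √(LBI.numRows V E * LBI.cMin Ψ S) := by
        rw [Real.sqrt_div' _ hl0.le, Real.sqrt_mul hl0.le]
        have := Real.sqrt_pos.2 hl0
        have : 0 < √Cmin := Real.sqrt_pos.2 hC1
        field_simp
        exact mul_comm _ _
      rw [h3] at hmin
      have h4 := hνc i
      rw [← le_div_iff₀' (Real.sqrt_pos.2 hc0)] at h4
      have h5 : 4 * σ * √(Real.log (Fintype.card E)) / √(LBI.numRows V E * LBI.cMin Ψ S)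
        = 2 * (2 * σ * √(Real.log (Fintype.card E)) / √(LBI.numRows V E * LBI.cMin Ψ S)) := by ring
      linarith
    · rw [LBI.eq_zero_of_notMem_supp he]
      exact congrArg _ (h2 e he)
  · obtain ⟨k, hk, hkb⟩ := LBI.exists_l2_bound hp hC1 hκ hΔt hσ hstep hlogm hνc hτ0 hC hτ
    refine ⟨k, hk, le_trans (le_of_eq ?_) hkb⟩
    obtain ⟨h1, h2⟩ := hpath k hk
    rw [LBI.norm2_eq]
    congr 1
    simp only [dotProduct, Pi.sub_apply, ← h1]
    refine Eq.trans ?_ (Finset.sum_coe_sort S fun e =>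
      (path ω k e - γ e) * (path ω k e - γ e)).symm
    refine (Finset.sum_subset (Finset.subset_univ _) fun e _ he => ?_).symm
    change (LBI.lbiPath _ _ _ _ _ e - γ e) * (LBI.lbiPath _ _ _ _ _ e - γ e) = 0
    rw [h2 e he, LBI.eq_zero_of_notMem_supp he]
    simp
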